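/- Let $\alpha\in(1,2]$ and $T>0$. Let $X=\{X_t,t\ge 0\}$ be a real-valued symmetric $\alpha$-stable process on a filtered probability space $(\Omega,\mathcal F,(\mathcal F_t)_{t\ge0},P)$, i.e. $X$ is $(\mathcal F_t)$-adapted with càdlàg paths, $X_0=0$ almost surely, and $$E\big[e^{iu(X_t-X_s)}\,\big|\,\mathcal F_s\big]=e^{-(t-s)|u|^\alpha}\quad\text{a.s., for all } t>s\ge 0,\ u\in\mathbb R.$$ For $\varepsilon>0$ put $p_\varepsilon(x)=(2\pi\varepsilon)^{-1/2}e^{-x^2/(2\varepsilon)}$ and $l_\varepsilon(T)=\int_0^T p_\varepsilon(X_t)\,dt$. Then the local time $l(T)=\int_0^T\delta(X_t)\,dt$ of $X$ at $0$, defined as the limit of $l_\varepsilon(T)$ in $L^2(P)$ as $\varepsilon\downarrow0$, exists, and $$\lim_{\varepsilon\downarrow0}\varepsilon^{-1}P\big(l(T)\le\varepsilon\big)=\frac{2}{T}\int_0^{\infty}\frac{\operatorname{Im}\big\{e^{i r/\sqrt2}\,\phi(re^{-3\pi i/4})\big\}}{|\phi(re^{3\pi i/4})|^2}\cdot\frac{e^{-r/\sqrt2}}{r}\,dr=\frac{\alpha\,T^{\frac1\alpha-1}}{\pi}\,\sin^2\!\Big(\frac{\pi}{\alpha}\Big)\,\Gamma\Big(1-\frac1\alpha\Big),$$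 where $\phi(z)=\int_{\mathbb R}\frac{dv}{z+T|v|^\alpha}$ for $z\in\mathbb C\setminus(-\infty,0]$; the integral defining $\phi(z)$ and the integral over $r$ converge absolutely. -/

import Mathlib

open MeasureTheory ProbabilityTheory Filter Topology Set
open scoped NNReal ENNReal

noncomputable section

/-- A path `[0, ∞) → ℝ` is càdlàg: right-continuous with (finite) left limits. At `0` the condition on
left limits is void. -/
def IsCadlagPath (x : ℝ≥0 → ℝ) : Prop :=
  ∀ t, ContinuousWithinAt x (Ici t) t ∧ ∃ y, Tendsto x (𝓝[<] t) (𝓝 y)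

/-- `X` is a symmetric `α`-stable process with respect to the filtration `ℱ`: it is adapted, has càdlàg
paths, starts at `0`, and `E[exp(i u (X_t - X_s)) | ℱ_s] = exp(-(t - s) |u|^α)` for `0 ≤ s < t`. -/
structure IsSymmetricStableProcess {Ω : Type*} {m : MeasurableSpace Ω} (α : ℝ)
    (X : ℝ≥0 → Ω → ℝ) (ℱ : Filtration ℝ≥0 m) (P : Measure Ω) : Prop where
  adapted : Adapted ℱ X
  cadlag : ∀ ω, IsCadlagPath fun t => X t ω
  start_zero : ∀ᵐ ω ∂P, X 0 ω = 0
  increment : ∀ s t : ℝ≥0, s < t → ∀ u : ℝ,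
    P[fun ω => Complex.exp (Complex.I * u * ((X t ω : ℂ) - X s ω)) | ℱ s]
      =ᵐ[P] fun _ => ((Real.exp (-((t : ℝ) - s) * |u| ^ α) : ℝ) : ℂ)

/-- The heat kernel `p_ε(x) = (2πε)^{-1/2} exp(-x²/(2ε))`, for `ε > 0`. -/
def heatKernel (ε x : ℝ) : ℝ :=
  (1 / Real.sqrt (2 * Real.pi * ε)) * Real.exp (-(x ^ 2) / (2 * ε))

/-- The regularized local time at `0`: `l_ε(T) = ∫₀ᵀ p_ε(X_t) dt`. -/
def approxLocalTime {Ω : Type*} (X : ℝ≥0 → Ω → ℝ) (T ε : ℝ) (ω : Ω) : ℝ :=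
  ∫ t in (0 : ℝ)..T, heatKernel ε (X t.toNNReal ω)

/-- `l` is (a version of) the local time `l(T) = ∫₀ᵀ δ(X_t) dt`: the limit in `L²(P)` of the regularized
local times `l_ε(T)` as `ε ↓ 0`. -/
def IsLocalTime {Ω : Type*} {m : MeasurableSpace Ω} (X : ℝ≥0 → Ω → ℝ) (T : ℝ) (P : Measure Ω)
    (l : Ω → ℝ) : Prop :=
  MemLp l 2 P ∧
    (∀ ε : ℝ, 0 < ε → MemLp (approxLocalTime X T ε) 2 P) ∧
    Tendsto (fun ε : ℝ => eLpNorm (fun ω => approxLocalTime X T ε ω - l ω) 2 P) (𝓝[>] 0) (𝓝 0)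

/-- The integrand `1 / (z + T |v|^α)` of `φ(z)`. -/
def phiIntegrand (α T : ℝ) (z : ℂ) (v : ℝ) : ℂ :=
  1 / (z + ((T * |v| ^ α : ℝ) : ℂ))

/-- `φ(z) = ∫_ℝ 1 / (z + T |v|^α) dv`, for `z ∈ ℂ ∖ (-∞, 0]`. -/
def phi (α T : ℝ) (z : ℂ) : ℂ :=
  ∫ v : ℝ, phiIntegrand α T z v

/-- The function
`r ↦ Im{e^{i r/√2} φ(r e^{-3πi/4})} / |φ(r e^{3πi/4})|² · e^{-r/√2} / r`, for `r > 0`. -/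
def contourIntegrand (α T r : ℝ) : ℝ :=
  (Complex.exp (Complex.I * ((r / Real.sqrt 2 : ℝ) : ℂ)) *
      phi α T (r * Complex.exp (-(Complex.I * ((3 * Real.pi / 4 : ℝ) : ℂ))))).im /
    ‖phi α T (r * Complex.exp (Complex.I * ((3 * Real.pi / 4 : ℝ) : ℂ)))‖ ^ 2 *
    (Real.exp (-(1 / Real.sqrt 2) * r) / r)

end

/-! Write `β = 1 - 1/α`. The law of the local time is identified through its moments, its behaviour
at `0` is extracted by a Tauberian argument, and the contour integral is evaluated separately
because `φ` is an explicit power.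

Moments. Since `l_ε(t)^(n+1)` is `(n+1) ∫₀ᵗ p_ε(X_s) l_ε(s)^n ds`, the Markov property and Fourier
inversion of `p_ε` give a recursion in `n` for `E[exp(iuX_t) l_ε(t)^n]`
(`integral_cexp_mul_approxLocalTime_pow`). Every term is nonnegative and is dominated by its
analogue at `ε = 0`, so dominated convergence applies. At `ε = 0` the recursion is a chain of Beta
integrals, with moments `κ^n n! / Γ(nβ + 1)`, where `κ = localTimeScale α T`
(`stableMoment_zero_eq`). The same recursion for two parameters shows that the inner products of
`l_ε(T)` and `l_ε'(T)` converge, hence the `L²` limit exists; all moments pass to it.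

Small values. The moments are those of a Mittag-Leffler law `ν`. If `S` is an independent standard
exponential variable and `Y` has law `ν`, then `S^β Y/κ` has moments `n!`, so it is exponential
(`map_rpow_mul_eq_expMeasure`). Conditioning on `S` and rescaling gives the Laplace transform in `u`
of `x⁻¹ ν(Iic (κ x u^(-β)))` at each positive integer `k`; as `x ↓ 0` it tends to `k^(β-1)`, the
transform of `u^(-β)/Γ(1-β)`. These functions are nonincreasing in `u`, so
`tendsto_of_tendsto_laplace` gives convergence at `u = 1`, which is the small ball limit `1/(κ
Γ(1-β))`.

Contour integral. On the slit plane `φ(z) = C z^(-β)` (`phi_eq_cpow`), which makes the contour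
integrand the imaginary part of a rotated Gamma integrand. Euler's reflection formula matches the
constants. -/

/-! ### A Tauberian theorem from Laplace transforms at the positive integers. -/

section Tauberian

/-- A bounded continuous weight of the form `g (exp (-u))` keeps `exp (-u) * r u` integrable. -/
theorem integrableOn_exp_neg_mul_comp {g r : ℝ → ℝ} (hg : Continuous g)
    (hr : IntegrableOn (fun u => Real.exp (-u) * r u) (Ioi 0)) :
    IntegrableOn (fun u => g (Real.exp (-u)) * (Real.exp (-u) * r u)) (Ioi 0) := by
  obtain ⟨C, hC⟩ := (isCompact_Icc (a := (0 : ℝ)) (b := 1)).exists_bound_of_continuousOn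
    hg.continuousOn
  refine Integrable.bdd_mul (c := C) hr (by fun_prop) ?_
  filter_upwards [ae_restrict_mem measurableSet_Ioi] with u hu
  exact hC _ ⟨(Real.exp_pos _).le, Real.exp_le_one_iff.2 (by simpa using le_of_lt hu)⟩

theorem integral_polynomial_exp_neg_mul {r : ℝ → ℝ}
    (hr : IntegrableOn (fun u => Real.exp (-u) * r u) (Ioi 0)) (p : Polynomial ℝ) :
    ∫ u in Ioi (0 : ℝ), p.eval (Real.exp (-u)) * (Real.exp (-u) * r u) =
      p.sum fun k a => a * ∫ u in Ioi (0 : ℝ), Real.exp (-((k + 1 : ℕ) * u)) * r u := by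
  simp_rw [Polynomial.eval_eq_sum, Polynomial.sum, Finset.sum_mul]
  rw [integral_finsetSum]
  · refine Finset.sum_congr rfl fun k _ => ?_
    rw [← integral_const_mul]
    refine integral_congr_ae (ae_of_all _ fun u => ?_)
    have : Real.exp (-(((k + 1 : ℕ) : ℝ) * u)) = Real.exp (-u) ^ k * Real.exp (-u) := by
      rw [← Real.exp_nat_mul, ← Real.exp_add]; congr 1; push_cast; ring
    simp only [this]; ring
  · intro k _
    exact integrableOn_exp_neg_mul_comp (g := fun y => p.coeff k * y ^ k) (by fun_prop) hr

variable {ι : Type*} {F : Filter ι} {R : ι → ℝ → ℝ} {q : ℝ → ℝ}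

/-- Weierstrass approximation: a polynomial in `exp (-u)`, multiplied by the extra factor `exp
(-u)`, is a combination of `exp (-(k * u))` with `k ≥ 1`. The transform at `k = 1` bounds the total
masses, so the approximation error is uniform along the filter. -/
theorem tendsto_integral_comp_exp_neg (hR0 : ∀ i, ∀ u ∈ Ioi (0 : ℝ), 0 ≤ R i u)
    (hRi : ∀ i, IntegrableOn (fun u => Real.exp (-u) * R i u) (Ioi 0))
    (hq0 : ∀ u ∈ Ioi (0 : ℝ), 0 ≤ q u)
    (hqi : IntegrableOn (fun u => Real.exp (-u) * q u) (Ioi 0))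
    (hlap : ∀ k : ℕ, 1 ≤ k → Tendsto (fun i => ∫ u in Ioi (0 : ℝ), Real.exp (-(k * u)) * R i u) F
      (𝓝 (∫ u in Ioi (0 : ℝ), Real.exp (-(k * u)) * q u)))
    {g : ℝ → ℝ} (hg : Continuous g) :
    Tendsto (fun i => ∫ u in Ioi (0 : ℝ), g (Real.exp (-u)) * (Real.exp (-u) * R i u)) F
      (𝓝 (∫ u in Ioi (0 : ℝ), g (Real.exp (-u)) * (Real.exp (-u) * q u))) := by
  have hpoly : ∀ p : Polynomial ℝ,
      Tendsto (fun i => ∫ u in Ioi (0 : ℝ), p.eval (Real.exp (-u)) * (Real.exp (-u) * R i u)) F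
      (𝓝 (∫ u in Ioi (0 : ℝ), p.eval (Real.exp (-u)) * (Real.exp (-u) * q u))) := by
    intro p
    simp_rw [fun i => integral_polynomial_exp_neg_mul (hRi i) p,
      integral_polynomial_exp_neg_mul hqi p, Polynomial.sum]
    exact tendsto_finsetSum _ fun k _ => (hlap (k + 1) (by omega)).const_mul _
  have happrox : ∀ (p : Polynomial ℝ) (η : ℝ),
      (∀ y ∈ Icc (0 : ℝ) 1, |p.eval y - g y| < η) → ∀ r : ℝ → ℝ, (∀ u ∈ Ioi (0 : ℝ), 0 ≤ r u) →
      IntegrableOn (fun u => Real.exp (-u) * r u) (Ioi 0) →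
      |(∫ u in Ioi (0 : ℝ), g (Real.exp (-u)) * (Real.exp (-u) * r u)) -
        ∫ u in Ioi (0 : ℝ), p.eval (Real.exp (-u)) * (Real.exp (-u) * r u)| ≤
        η * ∫ u in Ioi (0 : ℝ), Real.exp (-u) * r u := by
    intro p η hp r hr0 hri
    rw [← integral_sub (integrableOn_exp_neg_mul_comp hg hri)
      (integrableOn_exp_neg_mul_comp p.continuous hri), ← integral_const_mul, ← Real.norm_eq_abs]
    refine norm_integral_le_of_norm_le (hri.const_mul η) ?_
    filter_upwards [ae_restrict_mem measurableSet_Ioi] with u hu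
    rw [← sub_mul, norm_mul, Real.norm_eq_abs, Real.norm_eq_abs, abs_sub_comm,
      abs_of_nonneg (mul_nonneg (Real.exp_pos _).le (hr0 u hu))]
    refine mul_le_mul_of_nonneg_right (hp _ ⟨(Real.exp_pos _).le, ?_⟩).le
      (mul_nonneg (Real.exp_pos _).le (hr0 u hu))
    exact Real.exp_le_one_iff.2 (by simpa using le_of_lt hu)
  have h1 := hlap 1 le_rfl
  simp only [Nat.cast_one, one_mul] at h1
  set A := ∫ u in Ioi (0 : ℝ), Real.exp (-u) * q u with hA
  have hA0 : 0 ≤ A := setIntegral_nonneg measurableSet_Ioi fun u hu =>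
    mul_nonneg (Real.exp_pos _).le (hq0 u hu)
  rw [Metric.tendsto_nhds]
  intro η hη
  -- `A + 1` eventually bounds the mass of `R i` as well as that of `q`, so each of the three errors
  -- is at most `η / 3`.
  have hη' : 0 < η / (3 * (A + 1)) := by positivity
  obtain ⟨p, hp⟩ := exists_polynomial_near_of_continuousOn 0 1 g hg.continuousOn _ hη'
  have hq := happrox p _ hp q hq0 hqi
  filter_upwards [Metric.tendsto_nhds.1 (hpoly p) (η / 3) (by positivity),
    h1.eventually (gt_mem_nhds (show A < A + 1 by linarith))] with i hi1 hi2
  have hr := happrox p _ hp (R i) (hR0 i) (hRi i)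
  rw [Real.dist_eq] at hi1 ⊢
  have e1 : η / (3 * (A + 1)) * (A + 1) = η / 3 := by field_simp
  have e2 := mul_le_mul_of_nonneg_left hi2.le hη'.le
  have e3 : η / (3 * (A + 1)) * A ≤ η / 3 := by
    rw [← e1]; exact mul_le_mul_of_nonneg_left (by linarith) hη'.le
  rw [abs_lt] at hi1 ⊢
  rw [abs_le] at hq hr
  constructor <;> linarith [hq.1, hq.2, hr.1, hr.2, hi1.1, hi1.2]

/-- A Tauberian theorem: for nonincreasing nonnegative functions, convergence of the Laplace
transforms at the positive integers implies convergence at the continuity points of the limit. -/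
theorem tendsto_of_tendsto_laplace (hR0 : ∀ i, ∀ u ∈ Ioi (0 : ℝ), 0 ≤ R i u)
    (hRa : ∀ i, AntitoneOn (R i) (Ioi 0))
    (hRi : ∀ i, IntegrableOn (fun u => Real.exp (-u) * R i u) (Ioi 0))
    (hq0 : ∀ u ∈ Ioi (0 : ℝ), 0 ≤ q u) (hqa : AntitoneOn q (Ioi 0))
    (hqi : IntegrableOn (fun u => Real.exp (-u) * q u) (Ioi 0))
    (hlap : ∀ k : ℕ, 1 ≤ k → Tendsto (fun i => ∫ u in Ioi (0 : ℝ), Real.exp (-(k * u)) * R i u) F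
      (𝓝 (∫ u in Ioi (0 : ℝ), Real.exp (-(k * u)) * q u)))
    {x : ℝ} (hx : 0 < x) (hqc : ContinuousAt q x) :
    Tendsto (fun i => R i x) F (𝓝 (q x)) := by
  -- Averaging against a tent function supported on `(c, d)` traps the average of a nonincreasing
  -- `r` between `r d` and `r c`; convergence of averages then compares `R i` and `q` at shifted
  -- points.
  have key : ∀ c d : ℝ, 0 < c → c < d → ∀ η > 0,
      ∀ᶠ i in F, R i d < q c + η ∧ q d - η < R i c := by
    intro c d hc hcd η hη
    set a := Real.exp (-d)
    set b := Real.exp (-c)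
    have hab : a < b := Real.exp_lt_exp.2 (by linarith)
    set g : ℝ → ℝ := fun y => max 0 (min (y - a) (b - y))
    have hg : Continuous g := by fun_prop
    have hg0 : ∀ y, 0 ≤ g y := fun y => le_max_left _ _
    have hsupp : ∀ u, u ∉ Ioo c d → g (Real.exp (-u)) = 0 := by
      intro u hu
      refine max_eq_left ?_
      by_cases h : c < u
      · have : d ≤ u := not_lt.1 fun h' => hu ⟨h, h'⟩
        exact (min_le_left _ _).trans (sub_nonpos.2 (Real.exp_le_exp.2 (by linarith)))
      · exact (min_le_right _ _).trans
          (sub_nonpos.2 (Real.exp_le_exp.2 (by linarith [not_lt.1 h])))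
    have h1i : IntegrableOn (fun u => Real.exp (-u) * (1 : ℝ)) (Ioi 0) := by
      simpa using integrableOn_exp_neg_Ioi 0
    have hwi := integrableOn_exp_neg_mul_comp hg h1i
    set W := ∫ u in Ioi (0 : ℝ), g (Real.exp (-u)) * (Real.exp (-u) * 1)
    have hW : 0 < W := by
      rw [setIntegral_pos_iff_support_of_nonneg_ae
        (ae_of_all _ fun u => mul_nonneg (hg0 _) (by positivity)) hwi]
      refine lt_of_lt_of_le ?_ (measure_mono (s := Ioo c d) ?_)
      · simp [hcd]
      · intro u hu
        refine ⟨?_, hc.trans hu.1⟩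
        have : 0 < g (Real.exp (-u)) := lt_max_of_lt_right (lt_min
          (sub_pos.2 (Real.exp_lt_exp.2 (by linarith [hu.2])))
          (sub_pos.2 (Real.exp_lt_exp.2 (by linarith [hu.1]))))
        exact (mul_pos this (by positivity)).ne'
    have hbd : ∀ r : ℝ → ℝ, AntitoneOn r (Ioi 0) →
        IntegrableOn (fun u => Real.exp (-u) * r u) (Ioi 0) →
        r d * W ≤ (∫ u in Ioi (0 : ℝ), g (Real.exp (-u)) * (Real.exp (-u) * r u)) ∧
        (∫ u in Ioi (0 : ℝ), g (Real.exp (-u)) * (Real.exp (-u) * r u)) ≤ r c * W := by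
      intro r hra hri
      rw [← integral_const_mul, ← integral_const_mul]
      constructor
      · refine setIntegral_mono_on (hwi.const_mul _) (integrableOn_exp_neg_mul_comp hg hri)
          measurableSet_Ioi fun u hu => ?_
        by_cases h : u ∈ Ioo c d
        · have := hra hu (hc.trans hcd) h.2.le
          have h2 := mul_le_mul_of_nonneg_left this (mul_nonneg (hg0 (Real.exp (-u)))
            (Real.exp_pos (-u)).le)
          linarith
        · simp [hsupp u h]
      · refine setIntegral_mono_on (integrableOn_exp_neg_mul_comp hg hri) (hwi.const_mul _)
          measurableSet_Ioi fun u hu => ?_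
        by_cases h : u ∈ Ioo c d
        · have := hra hc hu h.1.le
          have h2 := mul_le_mul_of_nonneg_left this (mul_nonneg (hg0 (Real.exp (-u)))
            (Real.exp_pos (-u)).le)
          linarith
        · simp [hsupp u h]
    have hq := hbd q hqa hqi
    have hlim := tendsto_integral_comp_exp_neg hR0 hRi hq0 hqi hlap hg
    filter_upwards [Metric.tendsto_nhds.1 hlim (η * W) (by positivity)] with i hi
    have hr := hbd (R i) (hRa i) (hRi i)
    rw [Real.dist_eq, abs_lt] at hi
    constructor
    · refine lt_of_mul_lt_mul_right ?_ hW.le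
      linarith [hi.2, hr.1, hq.2]
    · refine lt_of_mul_lt_mul_right ?_ hW.le
      linarith [hi.1, hr.2, hq.1]
  rw [Metric.tendsto_nhds]
  intro η hη
  obtain ⟨δ, hδ, hqδ⟩ := Metric.continuousAt_iff.1 hqc (η / 2) (by positivity)
  set δ' := min (δ / 2) (x / 2)
  have hδ' : 0 < δ' := by positivity
  have hδ1 : δ' < δ := (min_le_left _ _).trans_lt (by linarith)
  have hδ2 : δ' < x := (min_le_right _ _).trans_lt (by linarith)
  have h1 := hqδ (x := x - δ') (by rw [Real.dist_eq]; simp [abs_of_pos hδ', hδ1])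
  have h2 := hqδ (x := x + δ') (by rw [Real.dist_eq]; simp [abs_of_pos hδ', hδ1])
  rw [Real.dist_eq, abs_lt] at h1 h2
  filter_upwards [key (x - δ') x (by linarith) (by linarith) (η / 2) (by positivity),
    key x (x + δ') hx (by linarith) (η / 2) (by positivity)] with i hi1 hi2
  rw [Real.dist_eq, abs_lt]
  constructor <;> linarith [hi1.1, hi2.2, h1.1, h1.2, h2.1, h2.2]

end Tauberian

/-! ### Mittag-Leffler laws: determination by moments and mass near zero. -/

section MomentProblem

/-- Tonelli on the exponential series: the moment `n!` cancels the coefficient `1 / n!`. The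
identity holds in `ℝ≥0∞`, so it also covers a divergent geometric series. -/
theorem lintegral_exp_mul_of_factorial_moments {μ : Measure ℝ} (h0 : ∀ᵐ x ∂μ, 0 ≤ x)
    (hmom : ∀ n : ℕ, ∫⁻ x, ENNReal.ofReal (x ^ n) ∂μ = ENNReal.ofReal n.factorial)
    {t : ℝ} (ht : 0 ≤ t) :
    ∫⁻ x, ENNReal.ofReal (Real.exp (t * x)) ∂μ = ∑' n : ℕ, ENNReal.ofReal (t ^ n) := by
  have h1 : ∀ᵐ x ∂μ, ENNReal.ofReal (Real.exp (t * x)) =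
      ∑' n : ℕ, ENNReal.ofReal (t ^ n / n.factorial) * ENNReal.ofReal (x ^ n) := by
    filter_upwards [h0] with x hx
    rw [Real.exp_eq_exp_ℝ, NormedSpace.exp_eq_tsum_div (𝔸 := ℝ)]
    rw [ENNReal.ofReal_tsum_of_nonneg (fun n => by positivity)
      (NormedSpace.expSeries_div_summable (t * x))]
    congr 1 with n
    rw [← ENNReal.ofReal_mul (by positivity)]
    congr 2
    rw [mul_pow]; ring
  rw [lintegral_congr_ae h1, lintegral_tsum (fun n => by fun_prop)]
  congr 1 with n
  rw [lintegral_const_mul _ (by fun_prop), hmom, ← ENNReal.ofReal_mul (by positivity)]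
  congr 2
  field_simp

theorem integrable_exp_mul_of_factorial_moments {μ : Measure ℝ} [IsFiniteMeasure μ]
    (h0 : ∀ᵐ x ∂μ, 0 ≤ x)
    (hmom : ∀ n : ℕ, ∫⁻ x, ENNReal.ofReal (x ^ n) ∂μ = ENNReal.ofReal n.factorial)
    {t : ℝ} (ht : t < 1) : Integrable (fun x => Real.exp (t * x)) μ := by
  rcases le_total t 0 with h | h
  · refine Integrable.of_bound (C := 1) (by fun_prop) ?_
    filter_upwards [h0] with x hx
    rw [Real.norm_eq_abs, Real.abs_exp]
    exact Real.exp_le_one_iff.2 (mul_nonpos_of_nonpos_of_nonneg h hx)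
  · refine ⟨by fun_prop, ?_⟩
    rw [hasFiniteIntegral_iff_ofReal (ae_of_all _ fun x => (Real.exp_pos _).le),
      lintegral_exp_mul_of_factorial_moments h0 hmom h,
      ← ENNReal.ofReal_tsum_of_nonneg (fun n => by positivity)
        (summable_geometric_of_lt_one h ht)]
    exact ENNReal.ofReal_lt_top

/-- A law on `[0, ∞)` with moments `n!` is determined by them. -/
theorem ext_of_factorial_moments {μ ν : Measure ℝ} [IsFiniteMeasure μ] [IsFiniteMeasure ν]
    (hμ0 : ∀ᵐ x ∂μ, 0 ≤ x) (hν0 : ∀ᵐ x ∂ν, 0 ≤ x)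
    (hμ : ∀ n : ℕ, ∫⁻ x, ENNReal.ofReal (x ^ n) ∂μ = ENNReal.ofReal n.factorial)
    (hν : ∀ n : ℕ, ∫⁻ x, ENNReal.ofReal (x ^ n) ∂ν = ENNReal.ofReal n.factorial) : μ = ν := by
  have hint : ∀ {μ : Measure ℝ} [IsFiniteMeasure μ], (∀ᵐ x ∂μ, 0 ≤ x) →
      (∀ n : ℕ, ∫⁻ x, ENNReal.ofReal (x ^ n) ∂μ = ENNReal.ofReal n.factorial) →
      AnalyticOnNhd ℂ (complexMGF id μ) {z | z.re < 1} := by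
    intro μ _ h0 hm z hz
    refine analyticAt_complexMGF (mem_interior.2 ⟨Iio 1, fun t ht => ?_, isOpen_Iio, hz⟩)
    exact integrable_exp_mul_of_factorial_moments h0 hm ht
  -- The two transforms agree at real points accumulating at `1/2`, hence on the half plane, which
  -- contains the imaginary axis carrying the characteristic functions.
  have hEq : EqOn (complexMGF id μ) (complexMGF id ν) {z | z.re < 1} := by
    have hconv : Convex ℝ {z : ℂ | z.re < 1} := convex_halfSpace_re_lt 1
    refine AnalyticOnNhd.eqOn_of_preconnected_of_frequently_eq (hint hμ0 hμ) (hint hν0 hν)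
      hconv.isPreconnected (z₀ := ((1 / 2 : ℝ) : ℂ)) ?_ ?_
    · rw [mem_ofPred_eq, Complex.ofReal_re]; norm_num
    · have hseq : Tendsto (fun n : ℕ => ((1 / 2 + 1 / ((n : ℝ) + 1) : ℝ) : ℂ)) atTop
          (𝓝[≠] ((1 / 2 : ℝ) : ℂ)) := by
        refine tendsto_nhdsWithin_iff.2 ⟨?_, Eventually.of_forall fun n => ?_⟩
        · refine (Complex.continuous_ofReal.tendsto _).comp ?_
          simpa using tendsto_one_div_add_atTop_nhds_zero_nat.const_add (1 / 2 : ℝ)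
        · have : (0 : ℝ) < 1 / ((n : ℝ) + 1) := by positivity
          simp only [mem_compl_iff, mem_singleton_iff, Complex.ofReal_inj]
          linarith
      -- The first two points are not below `1`, but no convergence is needed: both sides are
      -- `toReal` of the same series.
      refine hseq.frequently (Frequently.of_forall fun n => ?_)
      have ht : (0 : ℝ) ≤ 1 / 2 + 1 / ((n : ℝ) + 1) := by positivity
      rw [complexMGF_ofReal, complexMGF_ofReal]
      congr 1
      simp only [mgf, id]
      rw [integral_eq_lintegral_of_nonneg_ae (ae_of_all _ fun x => (Real.exp_pos _).le)
          (by fun_prop), integral_eq_lintegral_of_nonneg_ae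
          (ae_of_all _ fun x => (Real.exp_pos _).le) (by fun_prop),
        lintegral_exp_mul_of_factorial_moments hμ0 hμ ht,
        lintegral_exp_mul_of_factorial_moments hν0 hν ht]
  refine Measure.ext_of_charFun (funext fun t => ?_)
  rw [← complexMGF_id_mul_I, ← complexMGF_id_mul_I]
  exact hEq (by simp)

theorem expMeasure_one_eq :
    expMeasure 1 = (volume.restrict (Ioi 0)).withDensity fun x => ENNReal.ofReal (Real.exp (-x)) := by
  rw [expMeasure, gammaMeasure, ← withDensity_indicator measurableSet_Ioi]
  refine withDensity_congr_ae ?_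
  filter_upwards [compl_mem_ae_iff.2 (measure_singleton (0 : ℝ))] with x hx
  rcases lt_or_gt_of_ne (show x ≠ 0 from hx) with h | h
  · rw [gammaPDF_of_neg h, indicator_of_notMem (by simpa using h.le)]
  · rw [gammaPDF_of_nonneg h.le, indicator_of_mem (by simpa using h)]
    simp

theorem ae_expMeasure_one_pos : ∀ᵐ x ∂expMeasure 1, 0 < x := by
  rw [expMeasure_one_eq]
  exact (withDensity_absolutelyContinuous _ _).ae_le (ae_restrict_mem measurableSet_Ioi)

theorem lintegral_rpow_expMeasure_one {a : ℝ} (ha : 0 ≤ a) :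
    ∫⁻ x, ENNReal.ofReal (x ^ a) ∂expMeasure 1 = ENNReal.ofReal (Real.Gamma (a + 1)) := by
  rw [expMeasure_one_eq, lintegral_withDensity_eq_lintegral_mul _ (by fun_prop) (by fun_prop),
    Real.Gamma_eq_integral (by linarith), ofReal_integral_eq_lintegral_ofReal]
  · refine setLIntegral_congr_fun measurableSet_Ioi fun x hx => ?_
    simp only [Pi.mul_apply, add_sub_cancel_right]
    rw [← ENNReal.ofReal_mul (Real.exp_pos _).le]
  · exact Real.GammaIntegral_convergent (by linarith)
  · filter_upwards [ae_restrict_mem measurableSet_Ioi] with x hx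
    have : (0 : ℝ) < x := hx
    simp only [Pi.zero_apply]; positivity

theorem lintegral_pow_expMeasure_one (n : ℕ) :
    ∫⁻ x, ENNReal.ofReal (x ^ n) ∂expMeasure 1 = ENNReal.ofReal n.factorial := by
  have := lintegral_rpow_expMeasure_one (a := n) (by positivity)
  simpa [Real.Gamma_nat_eq_factorial] using this

variable {ν : Measure ℝ} [IsProbabilityMeasure ν] {κ β : ℝ}

/-- A Mittag-Leffler variable, multiplied by the `β`-th power of an independent exponential
variable, is exponential. -/
theorem map_rpow_mul_eq_expMeasure (hκ : 0 < κ) (hβ : 0 < β) (hν0 : ∀ᵐ x ∂ν, 0 ≤ x)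
    (hν : ∀ n : ℕ, ∫⁻ x, ENNReal.ofReal (x ^ n) ∂ν =
      ENNReal.ofReal (κ ^ n * n.factorial / Real.Gamma (n * β + 1))) :
    ((expMeasure 1).prod ν).map (fun p => p.1 ^ β * (p.2 / κ)) = expMeasure 1 := by
  have : IsProbabilityMeasure (expMeasure 1) := isProbabilityMeasure_expMeasure one_pos
  have hm : Measurable fun p : ℝ × ℝ => p.1 ^ β * (p.2 / κ) := by fun_prop
  have : IsProbabilityMeasure (((expMeasure 1).prod ν).map (fun p => p.1 ^ β * (p.2 / κ))) :=
    Measure.isProbabilityMeasure_map hm.aemeasurable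
  have hae : ∀ᵐ p ∂(expMeasure 1).prod ν, 0 < p.1 ∧ 0 ≤ p.2 :=
    (Measure.quasiMeasurePreserving_fst.ae ae_expMeasure_one_pos).and
      (Measure.quasiMeasurePreserving_snd.ae hν0)
  refine ext_of_factorial_moments ?_ (ae_expMeasure_one_pos.mono fun x hx => hx.le) ?_
    lintegral_pow_expMeasure_one
  · refine (ae_map_iff hm.aemeasurable (measurableSet_le measurable_const measurable_id)).2 ?_
    filter_upwards [hae] with p hp
    exact mul_nonneg (Real.rpow_nonneg hp.1.le _) (div_nonneg hp.2 hκ.le)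
  · intro n
    rw [lintegral_map (by fun_prop) hm]
    -- Independence factors the moment; the exponential variable contributes `Γ(nβ + 1)`, which
    -- cancels the denominator in `hν` and leaves `n!`.
    have h1 : ∀ᵐ p ∂(expMeasure 1).prod ν, ENNReal.ofReal ((p.1 ^ β * (p.2 / κ)) ^ n) =
        ENNReal.ofReal (p.1 ^ (n * β)) * (ENNReal.ofReal ((κ ^ n)⁻¹) * ENNReal.ofReal (p.2 ^ n)) := by
      filter_upwards [hae] with p hp
      have h1 := hp.1; have h2 := hp.2
      rw [← ENNReal.ofReal_mul (by positivity), ← ENNReal.ofReal_mul (by positivity)]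
      congr 1
      rw [mul_pow, ← Real.rpow_natCast (p.1 ^ β), ← Real.rpow_mul h1.le, div_pow, mul_comm β]
      field_simp
    rw [lintegral_congr_ae h1, lintegral_prod_mul (f := fun s : ℝ => ENNReal.ofReal (s ^ (n * β)))
        (g := fun y : ℝ => ENNReal.ofReal ((κ ^ n)⁻¹) * ENNReal.ofReal (y ^ n))
        (by fun_prop) (by fun_prop),
      lintegral_rpow_expMeasure_one (by positivity), lintegral_const_mul _ (by fun_prop), hν]
    have hG : 0 < Real.Gamma (n * β + 1) := Real.Gamma_pos_of_pos (by positivity)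
    rw [← ENNReal.ofReal_mul (by positivity), ← ENNReal.ofReal_mul (by positivity)]
    congr 1
    field_simp

/-- This is the distribution function at `x` of the exponential product, conditioned on its first
factor `t`: the condition `t^β y / κ ≤ x` means `y ≤ κ x t^(-β)`. -/
theorem integral_exp_neg_mul_measure_Iic (hκ : 0 < κ) (hβ : 0 < β) (hν0 : ∀ᵐ x ∂ν, 0 ≤ x)
    (hν : ∀ n : ℕ, ∫⁻ x, ENNReal.ofReal (x ^ n) ∂ν =
      ENNReal.ofReal (κ ^ n * n.factorial / Real.Gamma (n * β + 1))) {x : ℝ} (hx : 0 ≤ x) :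
    ∫ t in Ioi (0 : ℝ), Real.exp (-t) * ν.real (Iic (κ * x * t ^ (-β))) = 1 - Real.exp (-x) := by
  have : IsProbabilityMeasure (expMeasure 1) := isProbabilityMeasure_expMeasure one_pos
  have hm : Measurable fun p : ℝ × ℝ => p.1 ^ β * (p.2 / κ) := by fun_prop
  have h1 : (expMeasure 1) (Iic x) = ENNReal.ofReal (1 - Real.exp (-x)) := by
    have := cdf_expMeasure_eq one_pos x
    rw [cdf_eq_real, if_pos hx, one_mul] at this
    rw [← this, ofReal_measureReal]
  have h2 : (expMeasure 1) (Iic x) =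
      ∫⁻ t in Ioi (0 : ℝ), ENNReal.ofReal (Real.exp (-t) * ν.real (Iic (κ * x * t ^ (-β)))) := by
    conv_lhs => rw [← map_rpow_mul_eq_expMeasure hκ hβ hν0 hν]
    rw [Measure.map_apply hm measurableSet_Iic, Measure.prod_apply (hm measurableSet_Iic),
      expMeasure_one_eq, lintegral_withDensity_eq_lintegral_mul _ (by fun_prop)
        (measurable_measure_prodMk_left (hm measurableSet_Iic))]
    refine setLIntegral_congr_fun measurableSet_Ioi fun t ht => ?_
    have ht : 0 < t := ht
    rw [Pi.mul_apply, ENNReal.ofReal_mul (Real.exp_pos _).le, ofReal_measureReal]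
    congr 2
    ext y
    have hp : 0 < t ^ β := Real.rpow_pos_of_pos ht _
    simp only [mem_preimage, mem_Iic, Real.rpow_neg ht.le]
    rw [← div_eq_mul_inv, le_div_iff₀ hp, mul_div_assoc', div_le_iff₀ hκ]
    constructor <;> intro h <;> linarith
  have hmeas : Measurable fun t : ℝ => ν.real (Iic (κ * x * t ^ (-β))) := by
    simp_rw [← cdf_eq_real]
    exact (monotone_cdf ν).measurable.comp (by fun_prop)
  rw [integral_eq_lintegral_of_nonneg_ae (ae_of_all _ fun t => by positivity)
    (by fun_prop), ← h2, h1, ENNReal.toReal_ofReal]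
  simpa using hx

/-- The substitution `t = k u` replaces `x` by `x k^β`. -/
theorem integral_exp_neg_nat_mul_measure_Iic (hκ : 0 < κ) (hβ : 0 < β) (hν0 : ∀ᵐ x ∂ν, 0 ≤ x)
    (hν : ∀ n : ℕ, ∫⁻ x, ENNReal.ofReal (x ^ n) ∂ν =
      ENNReal.ofReal (κ ^ n * n.factorial / Real.Gamma (n * β + 1))) {x : ℝ} (hx : 0 ≤ x)
    {k : ℕ} (hk : 1 ≤ k) :
    ∫ u in Ioi (0 : ℝ), Real.exp (-(k * u)) * ν.real (Iic (κ * x * u ^ (-β))) =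
      (k : ℝ)⁻¹ * (1 - Real.exp (-(x * (k : ℝ) ^ β))) := by
  have hk0 : (0 : ℝ) < k := by exact_mod_cast hk
  rw [← integral_exp_neg_mul_measure_Iic hκ hβ hν0 hν (x := x * (k : ℝ) ^ β) (by positivity)]
  have := integral_comp_mul_left_Ioi (fun t : ℝ => Real.exp (-t) *
    ν.real (Iic (κ * (x * (k : ℝ) ^ β) * t ^ (-β)))) 0 hk0
  rw [mul_zero, smul_eq_mul] at this
  rw [← this]
  refine setIntegral_congr_fun measurableSet_Ioi fun u hu => ?_
  have hu : 0 < u := hu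
  have e : κ * (x * (k : ℝ) ^ β) * (k * u) ^ (-β) = κ * x * u ^ (-β) := by
    rw [Real.mul_rpow hk0.le hu.le, Real.rpow_neg hk0.le]
    have : (k : ℝ) ^ β ≠ 0 := (Real.rpow_pos_of_pos hk0 _).ne'
    field_simp
  simp only [e]

/-- The small ball asymptotics of a Mittag-Leffler law. -/
theorem tendsto_inv_mul_measure_Iic (hκ : 0 < κ) (hβ : 0 < β) (hβ1 : β < 1)
    (hν0 : ∀ᵐ x ∂ν, 0 ≤ x)
    (hν : ∀ n : ℕ, ∫⁻ x, ENNReal.ofReal (x ^ n) ∂ν =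
      ENNReal.ofReal (κ ^ n * n.factorial / Real.Gamma (n * β + 1))) :
    Tendsto (fun ε : ℝ => ε⁻¹ * ν.real (Iic ε)) (𝓝[>] 0)
      (𝓝 (κ⁻¹ * (Real.Gamma (1 - β))⁻¹)) := by
  have hG : 0 < Real.Gamma (1 - β) := Real.Gamma_pos_of_pos (by linarith)
  have hmeas : ∀ z : ℝ, Measurable fun t : ℝ => ν.real (Iic (z * t ^ (-β))) := fun z => by
    simp_rw [← cdf_eq_real]
    exact (monotone_cdf ν).measurable.comp (by fun_prop)
  have hanti : AntitoneOn (fun u : ℝ => u ^ (-β)) (Ioi 0) := fun a ha b hb hab =>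
    Real.rpow_le_rpow_of_nonpos ha hab (by linarith)
  have hqint : ∀ k : ℕ, 1 ≤ k → ∫ u in Ioi (0 : ℝ), Real.exp (-(k * u)) *
      (u ^ (-β) * (Real.Gamma (1 - β))⁻¹) = (k : ℝ)⁻¹ * (k : ℝ) ^ β := by
    intro k hk
    have hk0 : (0 : ℝ) < k := by exact_mod_cast hk
    have := Real.integral_rpow_mul_exp_neg_mul_Ioi (a := 1 - β) (by linarith) hk0
    calc _ = (Real.Gamma (1 - β))⁻¹ * ∫ u in Ioi (0 : ℝ), u ^ (1 - β - 1) * Real.exp (-(k * u)) := by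
          rw [← integral_const_mul]
          refine integral_congr_ae (ae_of_all _ fun u => ?_)
          have : 1 - β - 1 = -β := by ring
          simp only [this]; ring
      _ = _ := by
          rw [this, one_div, Real.inv_rpow hk0.le, Real.rpow_sub hk0, Real.rpow_one]
          field_simp
  -- The index `x` is the scale of the small ball. Absolute values make monotonicity and
  -- integrability hold for every real index, though only `x > 0` matters for the limit. The theorem
  -- is evaluated at `u = 1`.
  have main := tendsto_of_tendsto_laplace (F := 𝓝[>] (0 : ℝ))
    (R := fun x u => |x|⁻¹ * ν.real (Iic (κ * |x| * u ^ (-β))))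
    (q := fun u => u ^ (-β) * (Real.Gamma (1 - β))⁻¹) (x := 1)
    (fun x u _ => by positivity) ?_ ?_ ?_ ?_ ?_ ?_ one_pos ?_
  · have h1 : Tendsto (fun ε : ℝ => ε / κ) (𝓝[>] 0) (𝓝[>] 0) := by
      refine tendsto_nhdsWithin_iff.2 ⟨?_, ?_⟩
      · have : Tendsto (fun ε : ℝ => ε / κ) (𝓝 0) (𝓝 (0 / κ)) := by
          apply Continuous.tendsto; fun_prop
        rw [zero_div] at this
        exact this.mono_left nhdsWithin_le_nhds
      · filter_upwards [self_mem_nhdsWithin] with ε hε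
        exact div_pos hε hκ
    have h2 := (main.comp h1).const_mul κ⁻¹
    simp only [Real.one_rpow, one_mul] at h2
    refine h2.congr' ?_
    filter_upwards [self_mem_nhdsWithin] with ε hε
    have hε : 0 < ε := hε
    simp only [Function.comp, mul_one, abs_of_pos (div_pos hε hκ)]
    rw [mul_div_cancel₀ _ hκ.ne', ← mul_assoc]
    congr 1
    field_simp
  · intro x a ha b hb hab
    refine mul_le_mul_of_nonneg_left (measureReal_mono (Iic_subset_Iic.2 ?_)) (by positivity)
    exact mul_le_mul_of_nonneg_left (hanti ha hb hab) (by positivity)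
  · intro x
    have h1 : IntegrableOn (fun u : ℝ => Real.exp (-u)) (Ioi 0) := integrableOn_exp_neg_Ioi 0
    refine Integrable.mul_bdd (c := |x|⁻¹) h1
      ((hmeas _).const_mul _).aestronglyMeasurable (ae_of_all _ fun u => ?_)
    rw [Real.norm_of_nonneg (by positivity)]
    exact mul_le_of_le_one_right (by positivity) measureReal_le_one
  · intro u hu
    have : (0 : ℝ) < u := hu
    positivity
  · intro a ha b hb hab
    exact mul_le_mul_of_nonneg_right (hanti ha hb hab) (by positivity)
  · have := (Real.GammaIntegral_convergent (s := 1 - β) (by linarith)).mul_const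
      (Real.Gamma (1 - β))⁻¹
    refine this.congr (ae_of_all _ fun u => ?_)
    have : 1 - β - 1 = -β := by ring
    simp only [this]; ring
  · intro k hk
    have hk0 : (0 : ℝ) < k := by exact_mod_cast hk
    rw [hqint k hk]
    -- After division by `x`, the transform is `k⁻¹` times a difference quotient of this function at
    -- `0`, whose derivative is `k^β`.
    have hder : HasDerivAt (fun x : ℝ => 1 - Real.exp (-(x * (k : ℝ) ^ β))) ((k : ℝ) ^ β) 0 := by
      have := ((((hasDerivAt_id (0 : ℝ)).mul_const ((k : ℝ) ^ β)).neg).exp).const_sub 1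
      simpa using this
    have h1 := (hasDerivAt_iff_tendsto_slope.1 hder).mono_left
      (nhdsWithin_mono (0 : ℝ) (fun y (hy : 0 < y) => hy.ne'))
    refine (h1.const_mul (k : ℝ)⁻¹).congr' ?_
    filter_upwards [self_mem_nhdsWithin] with x hx
    have hx : 0 < x := hx
    have h2 := integral_exp_neg_nat_mul_measure_Iic hκ hβ hν0 hν hx.le hk
    rw [abs_of_pos hx]
    have h3 : ∀ u : ℝ, Real.exp (-(k * u)) * (x⁻¹ * ν.real (Iic (κ * x * u ^ (-β)))) =
        x⁻¹ * (Real.exp (-(k * u)) * ν.real (Iic (κ * x * u ^ (-β)))) := fun u => by ring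
    simp_rw [h3]
    rw [integral_const_mul, h2, slope_def_field]
    simp
    field_simp
  · exact (Real.continuousAt_rpow_const _ _ (Or.inl one_ne_zero)).mul continuousAt_const

end MomentProblem

/-! ### Integrals of stable type in the frequency variable. -/

section StableIntegrals

/-- Comparison with `(1 + |v|)^(-α)`, through `(1 + |v|)^α ≤ 2^α (1 + |v|^α)`. This majorant serves
both `φ` and the stable characteristic functions. -/
theorem integrable_inv_one_add_mul_abs_rpow {α T : ℝ} (hα : 1 < α) (hT : 0 < T) :
    Integrable fun v : ℝ => (1 + T * |v| ^ α)⁻¹ := by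
  have h1 : Integrable (fun v : ℝ => (1 + ‖v‖) ^ (-α)) := by
    apply integrable_one_add_norm
    simpa using hα
  set c := min 1 T
  have hc : 0 < c := lt_min one_pos hT
  refine (h1.const_mul (c⁻¹ * 2 ^ α)).mono' (Measurable.aestronglyMeasurable (by fun_prop)) (ae_of_all _ fun v => ?_)
  have hv := abs_nonneg v
  have hp : 0 ≤ |v| ^ α := by positivity
  rw [Real.norm_of_nonneg (by positivity), Real.norm_eq_abs, Real.rpow_neg (by positivity)]
  have h2 : (1 + |v|) ^ α ≤ 2 ^ α * (1 + |v| ^ α) := by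
    rcases le_total |v| 1 with h | h
    · calc (1 + |v|) ^ α ≤ 2 ^ α := Real.rpow_le_rpow (by positivity) (by linarith) (by linarith)
        _ ≤ 2 ^ α * (1 + |v| ^ α) := le_mul_of_one_le_right (by positivity) (by linarith)
    · calc (1 + |v|) ^ α ≤ (2 * |v|) ^ α :=
            Real.rpow_le_rpow (by positivity) (by linarith) (by linarith)
        _ = 2 ^ α * |v| ^ α := Real.mul_rpow (by norm_num) hv
        _ ≤ 2 ^ α * (1 + |v| ^ α) := by gcongr; linarith
  have h3 : c * (1 + |v| ^ α) ≤ 1 + T * |v| ^ α := by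
    have := mul_le_mul_of_nonneg_right (min_le_right 1 T) hp
    nlinarith [min_le_left 1 T]
  rw [← div_eq_mul_inv, le_div_iff₀ (by positivity), ← div_eq_inv_mul, div_le_iff₀ (by positivity)]
  rw [inv_mul_eq_div, div_mul_eq_mul_div, le_div_iff₀ hc]
  calc (1 + |v|) ^ α * c ≤ 2 ^ α * (1 + |v| ^ α) * c := by gcongr
    _ = 2 ^ α * (c * (1 + |v| ^ α)) := by ring
    _ ≤ _ := by gcongr

theorem integrable_exp_neg_mul_abs_rpow {α s : ℝ} (hα : 1 < α) (hs : 0 < s) :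
    Integrable fun v : ℝ => Real.exp (-(s * |v| ^ α)) := by
  refine (integrable_inv_one_add_mul_abs_rpow hα hs).mono'
    (Measurable.aestronglyMeasurable (by fun_prop)) (ae_of_all _ fun v => ?_)
  have : 0 ≤ s * |v| ^ α := by positivity
  rw [Real.norm_of_nonneg (Real.exp_pos _).le, Real.exp_neg]
  exact inv_anti₀ (by positivity) (by linarith [Real.add_one_le_exp (s * |v| ^ α)])

theorem integral_exp_neg_mul_abs_rpow {α s : ℝ} (hα : 1 < α) (hs : 0 < s) :
    ∫ v : ℝ, Real.exp (-(s * |v| ^ α)) = 2 * Real.Gamma (1 / α + 1) * s ^ (-(1 / α)) := by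
  have h := integral_comp_abs (f := fun x : ℝ => Real.exp (-(s * x ^ α)))
  have h2 := integral_exp_neg_mul_rpow (p := α) (by linarith) hs
  simp only [neg_mul] at h2
  rw [h, h2, neg_div]; ring

end StableIntegrals

/-! ### The function `φ` and the contour integral. -/

section Phi

variable {α T : ℝ}

/-- For bounded `s` the bound is the distance from `z` to the cut; for large `s` it is the triangle
inequality. Uniformity over a ball lets one majorant dominate the complex derivative of the
integrand of `φ`. -/
theorem exists_le_norm_add_of_mem_slitPlane {z : ℂ} (hz : z ∈ Complex.slitPlane) :
    ∃ ρ > 0, ∃ c > 0, ∀ w ∈ Metric.ball z ρ, ∀ s : ℝ, 0 ≤ s → c * (1 + s) ≤ ‖w + s‖ := by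
  obtain ⟨δ, hδ, hball⟩ := Metric.isOpen_iff.1 Complex.isOpen_slitPlane z hz
  set R := ‖z‖ + δ
  have hR : 0 < R := by positivity
  refine ⟨δ / 2, by positivity, min (1 / 2) (δ / 2 / (2 * R + 2)), by positivity, ?_⟩
  intro w hw s hs
  have hwz : ‖w - z‖ < δ / 2 := by simpa [dist_eq_norm] using hw
  have h1 : δ ≤ ‖z + s‖ := by
    by_contra! h
    have : -(s : ℂ) ∈ Metric.ball z δ := by
      rw [Metric.mem_ball, dist_comm, dist_eq_norm]; simpa using h
    have h2 := hball this
    rw [Complex.mem_slitPlane_iff] at h2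
    simp at h2; linarith
  have h2 : δ / 2 ≤ ‖w + s‖ := by
    have : ‖z + s‖ ≤ ‖w + s‖ + ‖w - z‖ := by
      calc ‖z + s‖ = ‖(w + s) - (w - z)‖ := by congr 1; ring
        _ ≤ _ := norm_sub_le _ _
    linarith
  have h3 : s - R ≤ ‖w + s‖ := by
    have h4 : ‖(s : ℂ)‖ ≤ ‖w + s‖ + ‖w - z‖ + ‖z‖ := by
      calc ‖(s : ℂ)‖ = ‖(w + s) - (w - z) - z‖ := by congr 1; ring
        _ ≤ _ := (norm_sub_le _ _).trans (by gcongr; exact norm_sub_le _ _)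
    rw [Complex.norm_real, Real.norm_of_nonneg hs] at h4
    simp only [R]; linarith
  rcases le_total s (2 * R + 1) with h | h
  · calc min (1 / 2) (δ / 2 / (2 * R + 2)) * (1 + s)
        ≤ δ / 2 / (2 * R + 2) * (2 * R + 2) :=
          mul_le_mul (min_le_right _ _) (by linarith) (by positivity) (by positivity)
      _ = δ / 2 := by field_simp
      _ ≤ _ := h2
  · calc min (1 / 2) (δ / 2 / (2 * R + 2)) * (1 + s) ≤ 1 / 2 * (1 + s) := by
          gcongr; exact min_le_left _ _
      _ ≤ s - R := by linarith
      _ ≤ _ := h3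

theorem hasDerivAt_phi (hα : 1 < α) (hT : 0 < T) {z : ℂ} (hz : z ∈ Complex.slitPlane) :
    Integrable (phiIntegrand α T z) ∧ DifferentiableAt ℂ (phi α T) z := by
  obtain ⟨ρ, hρ, c, hc, hbound⟩ := exists_le_norm_add_of_mem_slitPlane hz
  have hnn : ∀ v : ℝ, 0 ≤ T * |v| ^ α := fun v => by positivity
  have hb := fun w hw v => hbound w hw _ (hnn v)
  have hne : ∀ w ∈ Metric.ball z ρ, ∀ v : ℝ, w + ((T * |v| ^ α : ℝ) : ℂ) ≠ 0 := by
    intro w hw v h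
    have h1 := hb w hw v
    rw [h, norm_zero] at h1
    have : 0 < c * (1 + T * |v| ^ α) := by have := hnn v; positivity
    linarith
  have hint0 := integrable_inv_one_add_mul_abs_rpow hα hT
  have hmeas : ∀ w : ℂ, AEStronglyMeasurable (phiIntegrand α T w) volume := fun w => by
    unfold phiIntegrand
    exact Measurable.aestronglyMeasurable (by fun_prop)
  have hint : Integrable (phiIntegrand α T z) := by
    refine (hint0.const_mul c⁻¹).mono' (hmeas z) (ae_of_all _ fun v => ?_)
    rw [phiIntegrand, norm_div, norm_one, one_div, ← mul_inv]
    have := hnn v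
    exact inv_anti₀ (by positivity) (hb z (Metric.mem_ball_self hρ) v)
  refine ⟨hint, ?_⟩
  refine (hasDerivAt_integral_of_dominated_loc_of_deriv_le (F := phiIntegrand α T)
    (F' := fun w v => -1 / (w + ((T * |v| ^ α : ℝ) : ℂ)) ^ 2)
    (bound := fun v => (c ^ 2)⁻¹ * (1 + T * |v| ^ α)⁻¹) (Metric.ball_mem_nhds z hρ)
    (Eventually.of_forall hmeas) hint (Measurable.aestronglyMeasurable (by fun_prop))
    (ae_of_all _ fun v w hw => ?_) (hint0.const_mul _)
    (ae_of_all _ fun v w hw => ?_)).2.differentiableAt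
  · have := hnn v
    rw [norm_div, norm_neg, norm_one, one_div, ← mul_inv, norm_pow]
    refine inv_anti₀ (by positivity) ?_
    calc c ^ 2 * (1 + T * |v| ^ α) ≤ c ^ 2 * (1 + T * |v| ^ α) ^ 2 := by
          gcongr; nlinarith
      _ = (c * (1 + T * |v| ^ α)) ^ 2 := by ring
      _ ≤ _ := by
          gcongr; exact hb w hw v
  · have h1 := ((hasDerivAt_id w).add_const ((T * |v| ^ α : ℝ) : ℂ)).inv (hne w hw v)
    simp only [phiIntegrand, one_div]
    exact h1

/-- On the right half plane `φ` is a Laplace transform. -/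
theorem phi_eq_laplace (hα : 1 < α) (hT : 0 < T) {z : ℂ} (hz : 0 < z.re) :
    IntegrableOn (fun t : ℝ => ((t ^ (-(1 / α)) : ℝ) : ℂ) * Complex.exp (-(z * t))) (Ioi 0) ∧
    phi α T z = ((2 * Real.Gamma (1 / α + 1) * T ^ (-(1 / α)) : ℝ) : ℂ) *
      ∫ t in Ioi (0 : ℝ), ((t ^ (-(1 / α)) : ℝ) : ℂ) * Complex.exp (-(z * t)) := by
  have hnn : ∀ v : ℝ, 0 ≤ T * |v| ^ α := fun v => by positivity
  set A : ℝ → ℂ := fun v => -(z + ((T * |v| ^ α : ℝ) : ℂ))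
  have hA : ∀ v, (A v).re < 0 := fun v => by
    have := hnn v
    simp only [A, Complex.neg_re, Complex.add_re, Complex.ofReal_re]; linarith
  have hinner : ∀ v : ℝ, ∫ t in Ioi (0 : ℝ), Complex.exp (A v * t) = phiIntegrand α T z v := by
    intro v
    rw [integral_exp_mul_complex_Ioi (hA v)]
    simp [A, phiIntegrand, neg_div_neg_eq, -Complex.ofReal_mul, -neg_add_rev]
  have hslit : ∀ x : ℝ, 0 < x → (x : ℂ) ∈ Complex.slitPlane := fun x hx => by simp [hx]
  -- The absolute inner integral is the integrand of `φ` at the real point `Re z`, so Fubini reduces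
  -- to integrability there.
  have hnorm : ∀ v : ℝ, ∫ t in Ioi (0 : ℝ), ‖Complex.exp (A v * t)‖ =
      ‖phiIntegrand α T (z.re : ℂ) v‖ := by
    intro v
    have h1 : ∀ t : ℝ, ‖Complex.exp (A v * t)‖ = Real.exp (-((z.re + T * |v| ^ α) * t)) := by
      intro t
      rw [Complex.norm_exp]; congr 1
      simp [A, -Complex.ofReal_mul]; ring
    have h2 := Real.integral_rpow_mul_exp_neg_mul_Ioi (a := 1) one_pos
      (r := z.re + T * |v| ^ α) (by have := hnn v; positivity)
    simp only [sub_self, Real.rpow_zero, one_mul, Real.rpow_one, Real.Gamma_one, mul_one] at h2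
    simp_rw [h1]
    rw [h2, phiIntegrand, ← Complex.ofReal_add, norm_div, norm_one, Complex.norm_real,
      Real.norm_of_nonneg (by have := hnn v; positivity)]
  have hprod : Integrable (Function.uncurry fun (v t : ℝ) => Complex.exp (A v * t))
      (volume.prod (volume.restrict (Ioi (0 : ℝ)))) := by
    refine (integrable_prod_iff (Measurable.aestronglyMeasurable (by fun_prop))).2 ⟨?_, ?_⟩
    · exact ae_of_all _ fun v => integrableOn_exp_mul_complex_Ioi (hA v) 0
    · simp only [Function.uncurry]
      simp_rw [hnorm]
      exact (hasDerivAt_phi hα hT (hslit _ hz)).1.norm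
  have hinner2 : ∀ t ∈ Ioi (0 : ℝ), ∫ v : ℝ, Complex.exp (A v * t) =
      ((2 * Real.Gamma (1 / α + 1) * T ^ (-(1 / α)) : ℝ) : ℂ) *
        (((t ^ (-(1 / α)) : ℝ) : ℂ) * Complex.exp (-(z * t))) := by
    intro t ht
    have ht : 0 < t := ht
    have h1 : ∀ v : ℝ, Complex.exp (A v * t) =
        Complex.exp (-(z * t)) * ((Real.exp (-(T * t * |v| ^ α)) : ℝ) : ℂ) := by
      intro v
      rw [Complex.ofReal_exp, ← Complex.exp_add]; congr 1
      simp only [A]; push_cast; ring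
    simp_rw [h1]
    rw [integral_const_mul, integral_complex_ofReal, integral_exp_neg_mul_abs_rpow hα (by positivity),
      Real.mul_rpow hT.le ht.le]
    push_cast; ring
  have hK : ((2 * Real.Gamma (1 / α + 1) * T ^ (-(1 / α)) : ℝ) : ℂ) ≠ 0 := by
    have : 0 < Real.Gamma (1 / α + 1) := Real.Gamma_pos_of_pos (by positivity)
    exact Complex.ofReal_ne_zero.2 (by positivity)
  constructor
  · have h1 := hprod.integral_prod_right
    have h2 : IntegrableOn (fun t : ℝ => ((2 * Real.Gamma (1 / α + 1) * T ^ (-(1 / α)) : ℝ) : ℂ) *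
        (((t ^ (-(1 / α)) : ℝ) : ℂ) * Complex.exp (-(z * t)))) (Ioi 0) := by
      refine IntegrableOn.congr_fun (f := fun t : ℝ => ∫ v : ℝ, Complex.exp (A v * t)) h1 hinner2
        measurableSet_Ioi
    exact (integrable_const_mul_iff (IsUnit.mk0 _ hK) _).1 h2
  · rw [← integral_const_mul, ← setIntegral_congr_fun measurableSet_Ioi hinner2, phi]
    simp_rw [← hinner]
    exact integral_integral_swap hprod

/-- The value of `φ`. -/
theorem phi_eq_cpow (hα : 1 < α) (hT : 0 < T) {z : ℂ} (hz : z ∈ Complex.slitPlane) :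
    phi α T z = ((2 * Real.Gamma (1 / α + 1) * T ^ (-(1 / α)) * Real.Gamma (1 - 1 / α) : ℝ) : ℂ) *
      z ^ (-(1 - 1 / α : ℝ) : ℂ) := by
  have hβ : 0 < 1 - 1 / α := by
    rw [sub_pos, div_lt_one (by linarith)]; exact hα
  -- On the positive axis the Laplace integral is a Gamma integral; the identity theorem extends the
  -- formula to the slit plane.
  have hreal : ∀ x : ℝ, 0 < x → phi α T x =
      ((2 * Real.Gamma (1 / α + 1) * T ^ (-(1 / α)) * Real.Gamma (1 - 1 / α) : ℝ) : ℂ) *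
      (x : ℂ) ^ (-(1 - 1 / α : ℝ) : ℂ) := by
    intro x hx
    rw [(phi_eq_laplace hα hT (z := x) (by simpa using hx)).2]
    have h1 := Real.integral_rpow_mul_exp_neg_mul_Ioi hβ hx
    have h2 : 1 - 1 / α - 1 = -(1 / α) := by ring
    rw [h2] at h1
    have h3 : ∫ t in Ioi (0 : ℝ), ((t ^ (-(1 / α)) : ℝ) : ℂ) * Complex.exp (-(x * t)) =
        (((1 / x) ^ (1 - 1 / α) * Real.Gamma (1 - 1 / α) : ℝ) : ℂ) := by
      rw [← h1, ← integral_complex_ofReal]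
      congr 1 with t
      push_cast; rfl
    rw [h3, ← Complex.ofReal_neg, ← Complex.ofReal_cpow hx.le, ← Complex.ofReal_mul,
      ← Complex.ofReal_mul, one_div x, Real.inv_rpow hx.le, Real.rpow_neg hx.le]
    congr 1; ring
  have han1 : AnalyticOnNhd ℂ (phi α T) Complex.slitPlane :=
    DifferentiableOn.analyticOnNhd
      (fun z hz => (hasDerivAt_phi hα hT hz).2.differentiableWithinAt) Complex.isOpen_slitPlane
  have han2 : AnalyticOnNhd ℂ (fun z : ℂ => ((2 * Real.Gamma (1 / α + 1) * T ^ (-(1 / α)) *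
      Real.Gamma (1 - 1 / α) : ℝ) : ℂ) * z ^ (-(1 - 1 / α : ℝ) : ℂ)) Complex.slitPlane := by
    intro z hz
    exact analyticAt_const.mul (analyticAt_id.cpow analyticAt_const hz)
  have hpre : IsPreconnected Complex.slitPlane :=
    (Complex.starConvex_one_slitPlane.isPathConnected
      Complex.one_mem_slitPlane).isConnected.isPreconnected
  refine han1.eqOn_of_preconnected_of_frequently_eq han2 hpre Complex.one_mem_slitPlane ?_ hz
  have hseq : Tendsto (fun n : ℕ => ((1 + 1 / ((n : ℝ) + 1) : ℝ) : ℂ)) atTop (𝓝[≠] (1 : ℂ)) := by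
    refine tendsto_nhdsWithin_iff.2 ⟨?_, Eventually.of_forall fun n => ?_⟩
    · rw [← Complex.ofReal_one]
      refine (Complex.continuous_ofReal.tendsto _).comp ?_
      simpa using tendsto_one_div_add_atTop_nhds_zero_nat.const_add (1 : ℝ)
    · have : (0 : ℝ) < 1 / ((n : ℝ) + 1) := by positivity
      rw [mem_compl_iff, mem_singleton_iff, ← Complex.ofReal_one, Complex.ofReal_inj]
      linarith
  exact hseq.frequently (Frequently.of_forall fun n => hreal _ (by positivity))

theorem cpow_ofReal_mul_exp {r θ : ℝ} (hr : 0 < r) (hθ : -Real.pi < θ) (hθ' : θ ≤ Real.pi) (b : ℝ) :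
    ((r : ℂ) * Complex.exp (Complex.I * (θ : ℂ))) ^ (-b : ℂ) =
      ((r ^ (-b) : ℝ) : ℂ) * Complex.exp (-(Complex.I * ((b * θ : ℝ) : ℂ))) := by
  have hlog : Complex.log ((r : ℂ) * Complex.exp (Complex.I * (θ : ℂ))) =
      (Real.log r : ℂ) + Complex.I * (θ : ℂ) := by
    rw [Complex.log_ofReal_mul hr (Complex.exp_ne_zero _), Complex.log_exp] <;> simpa
  rw [Complex.cpow_def_of_ne_zero (mul_ne_zero (by exact_mod_cast hr.ne') (Complex.exp_ne_zero _)),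
    hlog, Real.rpow_def_of_pos hr, Complex.ofReal_exp, ← Complex.exp_add]
  congr 1
  push_cast; ring

theorem mul_exp_mem_slitPlane {r θ : ℝ} (hr : 0 < r) (hθ : -Real.pi < θ) (hθ' : θ < Real.pi) :
    (r : ℂ) * Complex.exp (Complex.I * (θ : ℂ)) ∈ Complex.slitPlane := by
  rw [Complex.mem_slitPlane_iff_arg]
  refine ⟨?_, mul_ne_zero (by exact_mod_cast hr.ne') (Complex.exp_ne_zero _)⟩
  rw [mul_comm Complex.I, Complex.exp_mul_I, Complex.arg_mul_cos_add_sin_mul_I hr ⟨hθ, hθ'.le⟩]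
  exact hθ'.ne

/-- Since `φ(z) = C z^(-β)`, the quotient of the `φ` factors is `C⁻¹ r^β exp(3πiβ/4)`, while the two
remaining exponentials combine to `exp(-r exp(-πi/4))`. The factor `1` in the exponent gives the
polar form used by `cpow_ofReal_mul_exp`. -/
theorem contourIntegrand_eq (hα : 1 < α) (hT : 0 < T) {r : ℝ} (hr : 0 < r) :
    contourIntegrand α T r =
      ((((2 * Real.Gamma (1 / α + 1) * T ^ (-(1 / α)) * Real.Gamma (1 - 1 / α))⁻¹ : ℝ) : ℂ) *
        Complex.exp (Complex.I * (((1 - 1 / α) * (3 * Real.pi / 4) : ℝ) : ℂ)) *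
        (((r ^ (-(1 / α)) : ℝ) : ℂ) *
          Complex.exp (-(((1 : ℝ) : ℂ) * Complex.exp (Complex.I * ((-(Real.pi / 4) : ℝ) : ℂ)) * r)))).im := by
  have hπ := Real.pi_pos
  have hβ : 0 < 1 - 1 / α := by
    rw [sub_pos, div_lt_one (by linarith)]; exact hα
  set β := 1 - 1 / α with hβd
  set C := 2 * Real.Gamma (1 / α + 1) * T ^ (-(1 / α)) * Real.Gamma β with hCd
  have hC : 0 < C := by
    have h1 : 0 < Real.Gamma (1 / α + 1) := Real.Gamma_pos_of_pos (by positivity)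
    have h2 : 0 < Real.Gamma β := Real.Gamma_pos_of_pos hβ
    positivity
  have hphi : ∀ z ∈ Complex.slitPlane, phi α T z = (C : ℂ) * z ^ (-(β : ℂ)) := fun z hz =>
    phi_eq_cpow hα hT hz
  have hphi1 : phi α T (r * Complex.exp (-(Complex.I * ((3 * Real.pi / 4 : ℝ) : ℂ)))) =
      ((C * r ^ (-β) : ℝ) : ℂ) * Complex.exp (Complex.I * ((β * (3 * Real.pi / 4) : ℝ) : ℂ)) := by
    have e : -(Complex.I * ((3 * Real.pi / 4 : ℝ) : ℂ)) =
        Complex.I * ((-(3 * Real.pi / 4) : ℝ) : ℂ) := by push_cast; ring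
    rw [e, hphi _ (mul_exp_mem_slitPlane hr (by linarith) (by linarith)),
      cpow_ofReal_mul_exp hr (by linarith) (by linarith), ← mul_assoc, ← Complex.ofReal_mul]
    congr 2
    push_cast; ring
  have hphi2 : ‖phi α T (r * Complex.exp (Complex.I * ((3 * Real.pi / 4 : ℝ) : ℂ)))‖ =
      C * r ^ (-β) := by
    rw [hphi _ (mul_exp_mem_slitPlane hr (by linarith) (by linarith)),
      cpow_ofReal_mul_exp hr (by linarith) (by linarith), ← mul_assoc, ← Complex.ofReal_mul,
      norm_mul, Complex.norm_exp, Complex.norm_real, Real.norm_of_nonneg (by positivity)]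
    simp
  have hw : Complex.exp (Complex.I * ((-(Real.pi / 4) : ℝ) : ℂ)) =
      ((1 / Real.sqrt 2 : ℝ) : ℂ) - Complex.I * ((1 / Real.sqrt 2 : ℝ) : ℂ) := by
    have h4 : Real.sqrt 2 / 2 = 1 / Real.sqrt 2 := by
      rw [div_eq_div_iff (by norm_num) (by positivity)]; norm_num
    rw [← h4]
    apply Complex.ext
    · rw [mul_comm Complex.I, Complex.exp_ofReal_mul_I_re, Real.cos_neg, Real.cos_pi_div_four]
      simp [-Complex.ofReal_div]
    · rw [mul_comm Complex.I, Complex.exp_ofReal_mul_I_im, Real.sin_neg, Real.sin_pi_div_four]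
      simp [-Complex.ofReal_div]
  rw [contourIntegrand, hphi1, hphi2, hw]
  have e1 : Complex.exp (-(((1 : ℝ) : ℂ) * (((1 / Real.sqrt 2 : ℝ) : ℂ) -
      Complex.I * ((1 / Real.sqrt 2 : ℝ) : ℂ)) * r)) =
      ((Real.exp (-(1 / Real.sqrt 2) * r) : ℝ) : ℂ) *
        Complex.exp (Complex.I * ((r / Real.sqrt 2 : ℝ) : ℂ)) := by
    rw [Complex.ofReal_exp, ← Complex.exp_add]; congr 1
    push_cast; ring
  rw [e1]
  set E1 := Complex.exp (Complex.I * ((r / Real.sqrt 2 : ℝ) : ℂ))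
  set E2 := Complex.exp (Complex.I * ((β * (3 * Real.pi / 4) : ℝ) : ℂ))
  have e2 : E1 * (((C * r ^ (-β) : ℝ) : ℂ) * E2) = ((C * r ^ (-β) : ℝ) : ℂ) * (E1 * E2) := by ring
  have e3 : ((C⁻¹ : ℝ) : ℂ) * E2 * (((r ^ (-(1 / α)) : ℝ) : ℂ) *
      (((Real.exp (-(1 / Real.sqrt 2) * r) : ℝ) : ℂ) * E1)) =
      ((C⁻¹ * r ^ (-(1 / α)) * Real.exp (-(1 / Real.sqrt 2) * r) : ℝ) : ℂ) * (E1 * E2) := by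
    push_cast; ring
  rw [e2, e3, Complex.im_ofReal_mul, Complex.im_ofReal_mul]
  have e4 : r ^ (-(1 / α)) = r ^ β / r := by
    rw [← Real.rpow_sub_one hr.ne']; congr 1; rw [hβd]; ring
  have hrβ : 0 < r ^ β := by positivity
  rw [e4, Real.rpow_neg hr.le]
  field_simp

/-- Equating `phi_eq_laplace` and `phi_eq_cpow` at `exp(-πi/4)` evaluates the rotated Gamma
integral. Its phase `πβ/4` adds to `3πβ/4`, whence `sin (πβ)`. -/
theorem contourIntegral_eq (hα : 1 < α) (hT : 0 < T) :
    IntegrableOn (contourIntegrand α T) (Ioi 0) ∧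
    ∫ r in Ioi (0 : ℝ), contourIntegrand α T r =
      Real.sin (Real.pi * (1 - 1 / α)) / (2 * Real.Gamma (1 / α + 1) * T ^ (-(1 / α))) := by
  have hπ := Real.pi_pos
  have hβ : 0 < 1 - 1 / α := by
    rw [sub_pos, div_lt_one (by linarith)]; exact hα
  have h1 : 0 < Real.Gamma (1 / α + 1) := Real.Gamma_pos_of_pos (by positivity)
  have h2 : 0 < Real.Gamma (1 - 1 / α) := Real.Gamma_pos_of_pos hβ
  set w : ℂ := ((1 : ℝ) : ℂ) * Complex.exp (Complex.I * ((-(Real.pi / 4) : ℝ) : ℂ)) with hw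
  have hwre : 0 < w.re := by
    rw [hw, Complex.re_ofReal_mul, mul_comm Complex.I, Complex.exp_ofReal_mul_I_re, one_mul]
    exact Real.cos_pos_of_mem_Ioo ⟨by linarith, by linarith⟩
  obtain ⟨hint, hval⟩ := phi_eq_laplace hα hT hwre
  rw [phi_eq_cpow hα hT (Or.inl hwre), hw,
    cpow_ofReal_mul_exp one_pos (by linarith) (by linarith), ← hw, Complex.ofReal_mul
      (2 * Real.Gamma (1 / α + 1) * T ^ (-(1 / α))), mul_assoc] at hval
  have hD : ((2 * Real.Gamma (1 / α + 1) * T ^ (-(1 / α)) : ℝ) : ℂ) ≠ 0 :=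
    Complex.ofReal_ne_zero.2 (by positivity)
  have hval' := mul_left_cancel₀ hD hval
  set Z := (((2 * Real.Gamma (1 / α + 1) * T ^ (-(1 / α)) * Real.Gamma (1 - 1 / α))⁻¹ : ℝ) : ℂ) *
        Complex.exp (Complex.I * (((1 - 1 / α) * (3 * Real.pi / 4) : ℝ) : ℂ))
  have hint' := hint.const_mul Z
  constructor
  · exact IntegrableOn.congr_fun (hint'.im) (fun r hr => (contourIntegrand_eq hα hT hr).symm)
      measurableSet_Ioi
  · rw [setIntegral_congr_fun measurableSet_Ioi (fun r hr => contourIntegrand_eq hα hT hr)]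
    have h3 := integral_im hint'
    simp only [RCLike.im_to_complex] at h3
    rw [h3, integral_const_mul, ← hval']
    simp only [Z, Real.one_rpow, Complex.ofReal_one, one_mul]
    have e : ∀ a b x y : ℂ, a * x * (b * y) = (a * b) * (x * y) := fun a b x y => by ring
    rw [e, ← Complex.exp_add, ← Complex.ofReal_mul, Complex.im_ofReal_mul]
    have e2 : Complex.I * (((1 - 1 / α) * (3 * Real.pi / 4) : ℝ) : ℂ) +
        -(Complex.I * (((1 - 1 / α) * -(Real.pi / 4) : ℝ) : ℂ)) =
        ((Real.pi * (1 - 1 / α) : ℝ) : ℂ) * Complex.I := by push_cast; ring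
    rw [e2, Complex.exp_ofReal_mul_I_im]
    set G := Real.Gamma (1 - 1 / α)
    field_simp

theorem two_div_mul_contourIntegral_eq (hα : 1 < α) (hT : 0 < T) :
    2 / T * ∫ r in Ioi (0 : ℝ), contourIntegrand α T r =
      α * T ^ (1 / α - 1) / Real.pi * Real.sin (Real.pi / α) ^ 2 * Real.Gamma (1 - 1 / α) := by
  have hα0 : 0 < α := by linarith
  have h1 : 0 < Real.Gamma (1 / α) := Real.Gamma_pos_of_pos (by positivity)
  have hsin : Real.sin (Real.pi * (1 - 1 / α)) = Real.sin (Real.pi / α) := by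
    rw [← Real.sin_pi_sub]; congr 1; ring
  have hrefl := Real.Gamma_mul_Gamma_one_sub (1 / α)
  have hs : 0 < Real.sin (Real.pi / α) := by
    refine Real.sin_pos_of_pos_of_lt_pi (by positivity) ?_
    rw [div_lt_iff₀ hα0]; nlinarith [Real.pi_pos]
  rw [mul_one_div] at hrefl
  have hG : Real.Gamma (1 - 1 / α) = Real.pi / Real.sin (Real.pi / α) / Real.Gamma (1 / α) := by
    rw [← hrefl]; field_simp
  rw [(contourIntegral_eq hα hT).2, hsin, hG, Real.Gamma_add_one (by positivity),
    Real.rpow_neg hT.le, Real.rpow_sub_one hT.ne']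
  have := Real.pi_pos
  field_simp

end Phi

/-! ### Path measurability, calculus along paths and the Markov property. -/

section Paths

/-- Times are approximated from the right by `(⌊(n+1) r⌋ + 1) / (n+1)`, so right continuity alone
controls the limit. -/
theorem exists_discretization_nnreal :
    ∃ (f : ℕ → ℝ≥0 → ℕ) (g : ℕ → ℕ → ℝ≥0), (∀ n, Measurable (f n)) ∧
      ∀ r, Tendsto (fun n => g n (f n r)) atTop (𝓝[≥] r) := by
  refine ⟨fun n r => ⌊((n : ℝ≥0) + 1) * r⌋₊, fun n k => ((k : ℝ≥0) + 1) / ((n : ℝ≥0) + 1),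
    fun n => Nat.measurable_floor.comp (measurable_id.const_mul _), fun r => ?_⟩
  have h1 : ∀ n : ℕ, r ≤ ((⌊((n : ℝ≥0) + 1) * r⌋₊ : ℝ≥0) + 1) / ((n : ℝ≥0) + 1) := fun n => by
    rw [le_div_iff₀ (by positivity), mul_comm]
    exact (Nat.lt_floor_add_one _).le
  have h2 : ∀ n : ℕ, ((⌊((n : ℝ≥0) + 1) * r⌋₊ : ℝ≥0) + 1) / ((n : ℝ≥0) + 1) ≤
      r + 1 / ((n : ℝ≥0) + 1) := fun n => by
    rw [div_le_iff₀ (by positivity), add_mul r, one_div, inv_mul_cancel₀ (by positivity),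
      mul_comm r]
    gcongr
    exact Nat.floor_le (by positivity)
  have h3 : Tendsto (fun n : ℕ => 1 / ((n : ℝ≥0) + 1)) atTop (𝓝 0) := by
    rw [← NNReal.tendsto_coe]
    push_cast
    exact tendsto_one_div_add_atTop_nhds_zero_nat
  have h4 := h3.const_add r
  rw [add_zero] at h4
  exact tendsto_nhdsWithin_iff.2 ⟨tendsto_of_tendsto_of_tendsto_of_le_of_le tendsto_const_nhds h4
    h1 h2, Eventually.of_forall h1⟩

/-- A right-continuous process is jointly measurable. -/
theorem measurable_uncurry_of_right_continuous {Ω : Type*} {m : MeasurableSpace Ω}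
    {Z : ℝ≥0 → Ω → ℝ} (hZ : ∀ t, Measurable (Z t))
    (hrc : ∀ ω t, ContinuousWithinAt (fun s => Z s ω) (Ici t) t) :
    Measurable fun p : ℝ≥0 × Ω => Z p.1 p.2 := by
  obtain ⟨f, g, hf, hfg⟩ := exists_discretization_nnreal
  refine measurable_of_tendsto_metrizable (f := fun n (p : ℝ≥0 × Ω) => Z (g n (f n p.1)) p.2)
    (fun n => ?_) (tendsto_pi_nhds.2 fun p => (hrc p.2 p.1).tendsto.comp (hfg p.1))
  have h1 : Measurable fun q : ℕ × Ω => Z (g n q.1) q.2 :=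
    measurable_from_prod_countable_right fun k => hZ (g n k)
  have h2 : Measurable fun p : ℝ≥0 × Ω => (f n p.1, p.2) :=
    ((hf n).comp measurable_fst).prodMk measurable_snd
  exact h1.comp h2

section FTC

variable {g g₁ g₂ : ℝ → ℝ}

theorem intervalIntegrable_of_bounded (hg : Measurable g) {C : ℝ} (hC : ∀ x, |g x| ≤ C) (a b : ℝ) :
    IntervalIntegrable g volume a b := by
  refine (intervalIntegrable_const (c := C)).mono_fun hg.aestronglyMeasurable
    (ae_of_all _ fun x => ?_)
  exact (hC x).trans (le_abs_self C)

theorem hasDerivWithinAt_primitive (hg : Measurable g) {C : ℝ} (hC : ∀ x, |g x| ≤ C) {t : ℝ}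
    (hrc : ContinuousWithinAt g (Ici t) t) :
    HasDerivWithinAt (fun s => ∫ r in (0 : ℝ)..s, g r) (g t) (Ioi t) t :=
  (intervalIntegral.integral_hasDerivWithinAt_right (s := Ici t) (t := Ioi t)
    (intervalIntegrable_of_bounded hg hC 0 t)
    hg.stronglyMeasurable.stronglyMeasurableAtFilter
    (hrc.mono Ioi_subset_Ici_self)).mono Ioi_subset_Ici_self

theorem continuous_primitive_of_bounded (hg : Measurable g) {C : ℝ} (hC : ∀ x, |g x| ≤ C) :
    Continuous fun s => ∫ r in (0 : ℝ)..s, g r :=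
  intervalIntegral.continuous_primitive (fun a b => intervalIntegrable_of_bounded hg hC a b) 0

/-- The fundamental theorem with right derivatives, which is all that right-continuous paths allow.
It peels off the latest time, the one to which the Markov property applies. -/
theorem primitive_pow_succ (hg : Measurable g) {C : ℝ} (hC : ∀ x, |g x| ≤ C)
    (hrc : ∀ t, 0 ≤ t → ContinuousWithinAt g (Ici t) t) (n : ℕ) {t : ℝ} (ht : 0 ≤ t) :
    (∫ r in (0 : ℝ)..t, g r) ^ (n + 1) =
      (n + 1) * ∫ s in (0 : ℝ)..t, g s * (∫ r in (0 : ℝ)..s, g r) ^ n := by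
  have hcont := continuous_primitive_of_bounded hg hC
  have hint : IntervalIntegrable (fun s => ((n : ℝ) + 1) * (g s * (∫ r in (0 : ℝ)..s, g r) ^ n))
      volume 0 t :=
    ((intervalIntegrable_of_bounded hg hC 0 t).mul_continuousOn
      (hcont.pow n).continuousOn).const_mul _
  have := intervalIntegral.integral_eq_sub_of_hasDeriv_right_of_le
    (f := fun s => (∫ r in (0 : ℝ)..s, g r) ^ (n + 1)) ht (hcont.pow _).continuousOn
    (fun s hs => ?_) hint
  · rw [intervalIntegral.integral_const_mul] at this
    simp at this
    linarith
  · have := (hasDerivWithinAt_primitive hg hC (hrc s hs.1.le)).pow (n + 1)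
    convert! this using 1
    push_cast
    ring

/-- Integration by parts; it splits a mixed second moment according to which of the two times is
later. -/
theorem primitive_mul_primitive (hg₁ : Measurable g₁) {C₁ : ℝ} (hC₁ : ∀ x, |g₁ x| ≤ C₁)
    (hrc₁ : ∀ t, 0 ≤ t → ContinuousWithinAt g₁ (Ici t) t)
    (hg₂ : Measurable g₂) {C₂ : ℝ} (hC₂ : ∀ x, |g₂ x| ≤ C₂)
    (hrc₂ : ∀ t, 0 ≤ t → ContinuousWithinAt g₂ (Ici t) t) {t : ℝ} (ht : 0 ≤ t) :
    (∫ r in (0 : ℝ)..t, g₁ r) * (∫ r in (0 : ℝ)..t, g₂ r) =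
      (∫ s in (0 : ℝ)..t, g₁ s * ∫ r in (0 : ℝ)..s, g₂ r) +
      ∫ s in (0 : ℝ)..t, g₂ s * ∫ r in (0 : ℝ)..s, g₁ r := by
  have hcont₁ := continuous_primitive_of_bounded hg₁ hC₁
  have hcont₂ := continuous_primitive_of_bounded hg₂ hC₂
  have hint₁ : IntervalIntegrable (fun s => g₁ s * ∫ r in (0 : ℝ)..s, g₂ r) volume 0 t :=
    (intervalIntegrable_of_bounded hg₁ hC₁ 0 t).mul_continuousOn hcont₂.continuousOn
  have hint₂ : IntervalIntegrable (fun s => g₂ s * ∫ r in (0 : ℝ)..s, g₁ r) volume 0 t :=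
    (intervalIntegrable_of_bounded hg₂ hC₂ 0 t).mul_continuousOn hcont₁.continuousOn
  rw [← intervalIntegral.integral_add hint₁ hint₂]
  have := intervalIntegral.integral_eq_sub_of_hasDeriv_right_of_le
    (f := fun s => (∫ r in (0 : ℝ)..s, g₁ r) * (∫ r in (0 : ℝ)..s, g₂ r)) ht
    (hcont₁.mul hcont₂).continuousOn
    (fun s hs => ?_) (hint₁.add hint₂)
  · simpa using this.symm
  · convert! (hasDerivWithinAt_primitive hg₁ hC₁ (hrc₁ s hs.1.le)).mul
      (hasDerivWithinAt_primitive hg₂ hC₂ (hrc₂ s hs.1.le)) using 1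
    ring

end FTC

section HeatKernel

theorem heatKernel_nonneg (ε x : ℝ) : 0 ≤ heatKernel ε x := by
  unfold heatKernel; positivity

theorem abs_heatKernel_le {ε : ℝ} (hε : 0 < ε) (x : ℝ) :
    |heatKernel ε x| ≤ 1 / Real.sqrt (2 * Real.pi * ε) := by
  rw [abs_of_nonneg (heatKernel_nonneg ε x), heatKernel]
  refine mul_le_of_le_one_right (by positivity) (Real.exp_le_one_iff.2 ?_)
  rw [neg_div]
  have : 0 ≤ x ^ 2 / (2 * ε) := by positivity
  linarith

theorem continuous_heatKernel (ε : ℝ) : Continuous (heatKernel ε) := by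
  unfold heatKernel; fun_prop

/-- Fourier inversion for the heat kernel. -/
theorem heatKernel_eq_integral {ε : ℝ} (hε : 0 < ε) (x : ℝ) :
    (heatKernel ε x : ℂ) = ((1 / (2 * Real.pi) : ℝ) : ℂ) *
      ∫ v : ℝ, Complex.exp (Complex.I * v * x) * ((Real.exp (-(ε * v ^ 2 / 2)) : ℝ) : ℂ) := by
  have h := fourierIntegral_gaussian (b := ((ε / 2 : ℝ) : ℂ)) (by simpa using hε) (x : ℂ)
  have h1 : ∀ v : ℝ, Complex.exp (Complex.I * v * x) * ((Real.exp (-(ε * v ^ 2 / 2)) : ℝ) : ℂ) =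
      Complex.exp (Complex.I * x * v) * Complex.exp (-((ε / 2 : ℝ) : ℂ) * (v : ℂ) ^ 2) := by
    intro v
    rw [Complex.ofReal_exp]
    congr 2
    · ring
    · push_cast; ring
  simp_rw [h1]
  rw [h]
  have h2 : ((Real.pi : ℂ) / ((ε / 2 : ℝ) : ℂ)) ^ (1 / 2 : ℂ) =
      ((Real.sqrt (Real.pi / (ε / 2)) : ℝ) : ℂ) := by
    rw [Real.sqrt_eq_rpow, Complex.ofReal_cpow (by positivity)]
    push_cast; rfl
  have h3 : Complex.exp (-(x : ℂ) ^ 2 / (4 * ((ε / 2 : ℝ) : ℂ))) =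
      ((Real.exp (-(x ^ 2) / (2 * ε)) : ℝ) : ℂ) := by
    rw [Complex.ofReal_exp]; congr 1
    push_cast; ring
  rw [h2, h3, ← Complex.ofReal_mul, ← Complex.ofReal_mul, heatKernel, ← mul_assoc]
  congr 2
  have hπ := Real.pi_pos
  have h4 : Real.sqrt (2 * Real.pi * ε) * Real.sqrt (Real.pi / (ε / 2)) = 2 * Real.pi := by
    rw [← Real.sqrt_mul (by positivity)]
    rw [show 2 * Real.pi * ε * (Real.pi / (ε / 2)) = (2 * Real.pi) ^ 2 by field_simp,
      Real.sqrt_sq (by positivity)]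
  have h5 : 0 < Real.sqrt (2 * Real.pi * ε) := by positivity
  rw [one_div_mul_eq_div, div_eq_div_iff h5.ne' (by positivity), one_mul, mul_comm (Real.sqrt (Real.pi / _)), h4]

end HeatKernel

section StableProcess

variable {Ω : Type*} {m : MeasurableSpace Ω} {P : Measure Ω}
  {ℱ : Filtration ℝ≥0 m} {X : ℝ≥0 → Ω → ℝ} {α : ℝ}

namespace IsSymmetricStableProcess

theorem measurable_uncurry (hX : IsSymmetricStableProcess α X ℱ P) :
    Measurable fun p : ℝ × Ω => X p.1.toNNReal p.2 := by
  have h := measurable_uncurry_of_right_continuous (Z := X) (fun t => hX.adapted.measurable)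
    (fun ω t => (hX.cadlag ω t).1)
  exact h.comp ((measurable_real_toNNReal.comp measurable_fst).prodMk measurable_snd)

theorem right_continuous (hX : IsSymmetricStableProcess α X ℱ P) (ω : Ω) (t : ℝ) :
    ContinuousWithinAt (fun s : ℝ => X s.toNNReal ω) (Ici t) t :=
  ContinuousWithinAt.comp (t := Ici t.toNNReal) (hX.cadlag ω t.toNNReal).1
    continuous_real_toNNReal.continuousWithinAt fun _ hs => Real.toNNReal_le_toNNReal hs

/-- Replacing `r` by `min r t` leaves the integral unchanged and makes the whole path `ℱ
t`-measurable. -/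
theorem measurable_approxLocalTime (hX : IsSymmetricStableProcess α X ℱ P) (ε : ℝ) {t : ℝ}
    (ht : 0 ≤ t) : Measurable[ℱ t.toNNReal] (approxLocalTime X t ε) := by
  have h := @measurable_uncurry_of_right_continuous Ω (ℱ t.toNNReal)
    (fun s => X (min s t.toNNReal))
    (fun s => hX.adapted.measurable_le (min_le_right _ _))
    (fun ω s => ContinuousWithinAt.comp (f := fun r => min r t.toNNReal)
      (t := Ici (min s t.toNNReal)) (hX.cadlag ω _).1
      (by fun_prop) fun r hr => min_le_min_right t.toNNReal hr)
  have h2 : Measurable[ℱ t.toNNReal] fun ω =>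
      ∫ r in (0 : ℝ)..t, heatKernel ε (X (min r.toNNReal t.toNNReal) ω) := by
    simp_rw [intervalIntegral.integral_of_le ht]
    have h3 : @Measurable _ _ (@Prod.instMeasurableSpace Ω ℝ (ℱ t.toNNReal) _) _ fun p : Ω × ℝ =>
        heatKernel ε (X (min p.2.toNNReal t.toNNReal) p.1) := by
      refine (continuous_heatKernel ε).measurable.comp ?_
      exact h.comp ((measurable_real_toNNReal.comp measurable_snd).prodMk measurable_fst)
    exact (@StronglyMeasurable.integral_prod_right' Ω ℝ ℝ (ℱ t.toNNReal) _
      (volume.restrict (Ioc 0 t)) _ _ _ _ h3.stronglyMeasurable).measurable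
  convert h2 using 2 with ω
  refine intervalIntegral.integral_congr fun r hr => ?_
  rw [uIcc_of_le ht] at hr
  rw [min_eq_left (Real.toNNReal_le_toNNReal hr.2)]

theorem measurable_path (hX : IsSymmetricStableProcess α X ℱ P) (ε : ℝ) (ω : Ω) :
    Measurable fun r : ℝ => heatKernel ε (X r.toNNReal ω) :=
  (continuous_heatKernel ε).measurable.comp (hX.measurable_uncurry.comp measurable_prodMk_right)

theorem right_continuous_path (hX : IsSymmetricStableProcess α X ℱ P) (ε : ℝ) (ω : Ω) (t : ℝ) :
    ContinuousWithinAt (fun r : ℝ => heatKernel ε (X r.toNNReal ω)) (Ici t) t :=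
  (continuous_heatKernel ε).continuousAt.comp_continuousWithinAt (hX.right_continuous ω t)

theorem measurable_uncurry_approxLocalTime (hX : IsSymmetricStableProcess α X ℱ P) {ε : ℝ}
    (hε : 0 < ε) : Measurable fun p : ℝ × Ω => approxLocalTime X (max p.1 0) ε p.2 := by
  refine measurable_uncurry_of_continuous_of_measurable (u := fun (t : ℝ) ω =>
    approxLocalTime X (max t 0) ε ω) (fun ω => ?_) fun t => ?_
  · exact (continuous_primitive_of_bounded (hX.measurable_path ε ω)
      (fun x => abs_heatKernel_le hε _)).comp (by fun_prop)
  · exact (hX.measurable_approxLocalTime ε (le_max_right _ _)).mono (ℱ.le _) le_rfl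

theorem _root_.approxLocalTime_nonneg (X : ℝ≥0 → Ω → ℝ) (ε : ℝ) {t : ℝ} (ht : 0 ≤ t) (ω : Ω) :
    0 ≤ approxLocalTime X t ε ω :=
  intervalIntegral.integral_nonneg ht fun _ _ => heatKernel_nonneg _ _

theorem _root_.approxLocalTime_le (X : ℝ≥0 → Ω → ℝ) {ε : ℝ} (hε : 0 < ε) {t : ℝ} (ht : 0 ≤ t)
    (ω : Ω) : approxLocalTime X t ε ω ≤ 1 / Real.sqrt (2 * Real.pi * ε) * t := by
  have := intervalIntegral.norm_integral_le_of_norm_le_const (a := 0) (b := t)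
    (f := fun r : ℝ => heatKernel ε (X r.toNNReal ω)) (C := 1 / Real.sqrt (2 * Real.pi * ε))
    (fun r _ => abs_heatKernel_le hε _)
  rw [sub_zero, abs_of_nonneg ht] at this
  exact (le_abs_self _).trans this

variable [IsProbabilityMeasure P]

/-- The Markov property, at the level of characteristic functions. -/
theorem integral_cexp_mul (hX : IsSymmetricStableProcess α X ℱ P) {s t : ℝ≥0} (hst : s ≤ t) (u : ℝ)
    {g : Ω → ℂ} (hg : Measurable[ℱ s] g) {M : ℝ} (hM : ∀ ω, ‖g ω‖ ≤ M) :
    ∫ ω, Complex.exp (Complex.I * u * X t ω) * g ω ∂P =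
      ((Real.exp (-((t : ℝ) - s) * |u| ^ α) : ℝ) : ℂ) *
        ∫ ω, Complex.exp (Complex.I * u * X s ω) * g ω ∂P := by
  rcases hst.eq_or_lt with rfl | hlt
  · simp
  have hnorm : ∀ x : ℝ, ‖Complex.exp (Complex.I * u * x)‖ = 1 := fun x => by
    rw [Complex.norm_exp]; simp
  have hXs : Measurable[ℱ s] (X s) := hX.adapted s
  have hXs' : Measurable (X s) := hX.adapted.measurable
  have hXt' : Measurable (X t) := hX.adapted.measurable
  have hg' : Measurable g := hg.mono (ℱ.le s) le_rfl
  set Z : Ω → ℂ := fun ω => Complex.exp (Complex.I * u * ((X t ω : ℂ) - X s ω))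
  set h : Ω → ℂ := fun ω => Complex.exp (Complex.I * u * X s ω) * g ω
  have hZn : ∀ ω, ‖Z ω‖ = 1 := fun ω => by
    have := hnorm (X t ω - X s ω); rwa [Complex.ofReal_sub] at this
  have hhn : ∀ ω, ‖h ω‖ ≤ M := fun ω => by
    simp only [h]; rw [norm_mul, hnorm, one_mul]; exact hM ω
  have hh : Measurable[ℱ s] h := by
    refine Measurable.mul ?_ hg
    exact Complex.measurable_exp.comp ((Complex.measurable_ofReal.comp hXs).const_mul _)
  have hZm : Measurable Z := by fun_prop
  have hZi : Integrable Z P := Integrable.of_bound hZm.aestronglyMeasurable 1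
    (ae_of_all _ fun ω => (hZn ω).le)
  have hZhi : Integrable (fun ω => ContinuousLinearMap.mul ℝ ℂ (Z ω) (h ω)) P := by
    refine Integrable.of_bound (hZm.mul (hh.mono (ℱ.le s) le_rfl)).aestronglyMeasurable M
      (ae_of_all _ fun ω => ?_)
    rw [ContinuousLinearMap.mul_apply', norm_mul, hZn, one_mul]
    exact hhn ω
  -- The `ℱ s`-measurable factor `exp(iuX_s) g` leaves the conditional expectation; what remains is
  -- that of the increment.
  have hcond := condExp_bilin_of_stronglyMeasurable_right (ContinuousLinearMap.mul ℝ ℂ)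
    hh.stronglyMeasurable hZhi hZi
  calc ∫ ω, Complex.exp (Complex.I * u * X t ω) * g ω ∂P
      = ∫ ω, ContinuousLinearMap.mul ℝ ℂ (Z ω) (h ω) ∂P := by
        congr 1 with ω
        simp only [ContinuousLinearMap.mul_apply', Z, h]
        rw [← mul_assoc, ← Complex.exp_add]
        congr 2; ring
    _ = ∫ ω, (P[fun ω => ContinuousLinearMap.mul ℝ ℂ (Z ω) (h ω) | ℱ s]) ω ∂P :=
        (integral_condExp (ℱ.le s)).symm
    _ = ∫ ω, ((Real.exp (-((t : ℝ) - s) * |u| ^ α) : ℝ) : ℂ) * h ω ∂P := by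
        refine integral_congr_ae ?_
        filter_upwards [hcond, hX.increment s t hlt u] with ω h1 h2
        rw [h1, ContinuousLinearMap.mul_apply', h2]
    _ = _ := integral_const_mul _ _

theorem integral_cexp (hX : IsSymmetricStableProcess α X ℱ P) (t : ℝ≥0) (u : ℝ) :
    ∫ ω, Complex.exp (Complex.I * u * X t ω) ∂P = ((Real.exp (-(t * |u| ^ α)) : ℝ) : ℂ) := by
  have h1 := hX.integral_cexp_mul (zero_le (a := t)) u (g := fun _ => 1) measurable_const (M := 1)
    (by simp)
  have h2 : ∫ ω, Complex.exp (Complex.I * u * X 0 ω) ∂P = 1 := by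
    rw [integral_congr_ae (g := fun _ => (1 : ℂ))]
    · simp
    · filter_upwards [hX.start_zero] with ω h
      simp [h]
  simpa [h2, -Complex.ofReal_exp] using h1

end IsSymmetricStableProcess

end StableProcess

end Paths

/-! ### The moment recursion and its limit at `ε = 0`. -/

noncomputable section

section MomentRecursion

/-- The Beta integral over `(0, t]`. -/
theorem lintegral_rpow_mul_sub_rpow {a b t : ℝ} (ha : 0 < a) (hb : 0 < b) (ht : 0 < t) :
    ∫⁻ s in Ioc 0 t, ENNReal.ofReal (s ^ (a - 1) * (t - s) ^ (b - 1)) =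
      ENNReal.ofReal (t ^ (a + b - 1) * (Real.Gamma a * Real.Gamma b / Real.Gamma (a + b))) := by
  have hGa := Real.Gamma_pos_of_pos ha
  have hGb := Real.Gamma_pos_of_pos hb
  have hGab := Real.Gamma_pos_of_pos (add_pos ha hb)
  have hc : ((∫ s in Ioc 0 t, s ^ (a - 1) * (t - s) ^ (b - 1) : ℝ) : ℂ) =
      ((t ^ (a + b - 1) * (Real.Gamma a * Real.Gamma b / Real.Gamma (a + b)) : ℝ) : ℂ) := by
    have h1 := Complex.betaIntegral_scaled a b ht
    rw [Complex.betaIntegral_eq_Gamma_mul_div a b (by simpa) (by simpa)] at h1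
    rw [← intervalIntegral.integral_of_le ht.le, ← intervalIntegral.integral_ofReal]
    have h2 : ((t : ℂ) ^ ((a : ℂ) + b - 1) * (Complex.Gamma a * Complex.Gamma b /
        Complex.Gamma ((a : ℂ) + b))) =
        ((t ^ (a + b - 1) * (Real.Gamma a * Real.Gamma b / Real.Gamma (a + b)) : ℝ) : ℂ) := by
      push_cast [Complex.ofReal_cpow ht.le, ← Complex.Gamma_ofReal]
      rfl
    rw [← h2, ← h1]
    refine intervalIntegral.integral_congr fun x hx => ?_
    rw [uIcc_of_le ht.le] at hx
    push_cast [Complex.ofReal_cpow hx.1, Complex.ofReal_cpow (sub_nonneg.2 hx.2)]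
    rfl
  have hr := Complex.ofReal_inj.1 hc
  have hint : IntegrableOn (fun s => s ^ (a - 1) * (t - s) ^ (b - 1)) (Ioc 0 t) := by
    -- A non-integrable function would have integral `0`, against the positive value just found.
    by_contra h
    rw [integral_undef h] at hr
    have : 0 < t ^ (a + b - 1) * (Real.Gamma a * Real.Gamma b / Real.Gamma (a + b)) := by
      positivity
    linarith
  rw [← hr, ofReal_integral_eq_lintegral_ofReal hint]
  filter_upwards [ae_restrict_mem measurableSet_Ioc] with s hs
  have h1 := hs.1
  have h2 := sub_nonneg.2 hs.2
  simp only [Pi.zero_apply]; positivity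

/-- The average `(2π)⁻¹ ∫ exp(-ε v² / 2) B (u + v) dv`. -/
def heatAverage (ε : ℝ) (B : ℝ → ℝ≥0∞) (u : ℝ) : ℝ≥0∞ :=
  ENNReal.ofReal (1 / (2 * Real.pi)) *
    ∫⁻ v : ℝ, ENNReal.ofReal (Real.exp (-(ε * v ^ 2 / 2))) * B (u + v)

/-- One step of the recursion for the functions `E[exp(i u X_t) l_ε(t)^n]`. -/
def stableStep (α ε : ℝ) (B : ℝ → ℝ → ℝ≥0∞) (t u : ℝ) : ℝ≥0∞ :=
  ∫⁻ s in Ioc 0 t, ENNReal.ofReal (Real.exp (-((t - s) * |u| ^ α))) * heatAverage ε (B s) u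

/-- The function `E[exp(i u X_t) l_ε(t)^n]`; for `ε = 0` its limit as `ε ↓ 0`. -/
def stableMoment (α ε : ℝ) : ℕ → ℝ → ℝ → ℝ≥0∞
  | 0, t, u => ENNReal.ofReal (Real.exp (-(t * |u| ^ α)))
  | n + 1, t, u => (n + 1 : ℕ) * stableStep α ε (stableMoment α ε n) t u

variable {α ε : ℝ}

theorem measurable_heatAverage {B : ℝ → ℝ → ℝ≥0∞} (hB : Measurable (Function.uncurry B)) (ε : ℝ) :
    Measurable fun p : ℝ × ℝ => heatAverage ε (B p.1) p.2 := by
  refine Measurable.const_mul (Measurable.lintegral_prod_right' (f := fun q : (ℝ × ℝ) × ℝ =>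
    ENNReal.ofReal (Real.exp (-(ε * q.2 ^ 2 / 2))) * B q.1.1 (q.1.2 + q.2)) ?_) _
  have h : Measurable fun q : (ℝ × ℝ) × ℝ => B q.1.1 (q.1.2 + q.2) :=
    hB.comp (f := fun q : (ℝ × ℝ) × ℝ => (q.1.1, q.1.2 + q.2)) (by fun_prop)
  exact Measurable.mul (by fun_prop) h

theorem measurable_stableStep {B : ℝ → ℝ → ℝ≥0∞} (hB : Measurable (Function.uncurry B))
    (α ε : ℝ) : Measurable (Function.uncurry (stableStep α ε B)) := by
  have h1 : Function.uncurry (stableStep α ε B) = fun p : ℝ × ℝ => ∫⁻ s,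
      {q : (ℝ × ℝ) × ℝ | 0 < q.2 ∧ q.2 ≤ q.1.1}.indicator (fun q =>
        ENNReal.ofReal (Real.exp (-((q.1.1 - q.2) * |q.1.2| ^ α))) *
          heatAverage ε (B q.2) q.1.2) (p, s) := by
    ext p
    simp only [Function.uncurry, stableStep]
    rw [← lintegral_indicator measurableSet_Ioc]
    rfl
  rw [h1]
  refine Measurable.lintegral_prod_right' (Measurable.indicator ?_ ?_)
  · have h2 : Measurable fun q : (ℝ × ℝ) × ℝ => heatAverage ε (B q.2) q.1.2 :=
      (measurable_heatAverage hB ε).comp (f := fun q : (ℝ × ℝ) × ℝ => (q.2, q.1.2)) (by fun_prop)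
    exact Measurable.mul (by fun_prop) h2
  · exact (measurableSet_lt measurable_const measurable_snd).inter
      (measurableSet_le measurable_snd (by fun_prop))

theorem measurable_stableMoment (α ε : ℝ) (n : ℕ) :
    Measurable (Function.uncurry (stableMoment α ε n)) := by
  induction n with
  | zero =>
    simp only [stableMoment, Function.uncurry_def]
    fun_prop
  | succ n ih => exact (measurable_stableStep ih α ε).const_mul _

theorem heatAverage_mono {B B' : ℝ → ℝ≥0∞} (hε : 0 ≤ ε) (h : ∀ v, B v ≤ B' v) (u : ℝ) :
    heatAverage ε B u ≤ heatAverage 0 B' u := by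
  refine mul_le_mul_right (lintegral_mono fun v => mul_le_mul' (ENNReal.ofReal_le_ofReal ?_)
    (h _)) _
  have : 0 ≤ ε * v ^ 2 / 2 := by positivity
  simpa using this

theorem stableStep_mono {B B' : ℝ → ℝ → ℝ≥0∞} (hε : 0 ≤ ε) (h : ∀ s v, B s v ≤ B' s v) (t u : ℝ) :
    stableStep α ε B t u ≤ stableStep α 0 B' t u :=
  lintegral_mono fun s => mul_le_mul_right (heatAverage_mono hε (h s) u) _

/-- The Gaussian weight is at most `1`. The case `ε = 0` is therefore the majorant for every limit
`ε ↓ 0`. -/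
theorem stableMoment_le (hε : 0 ≤ ε) (n : ℕ) (t u : ℝ) :
    stableMoment α ε n t u ≤ stableMoment α 0 n t u := by
  induction n generalizing t u with
  | zero => exact le_rfl
  | succ n ih => exact mul_le_mul_right (stableStep_mono hε ih t u) _

/-- Translation invariance: without the Gaussian weight the average no longer depends on `u`, so the
limiting recursion closes on functions of time alone. -/
theorem heatAverage_zero (B : ℝ → ℝ≥0∞) (u : ℝ) :
    heatAverage 0 B u = ENNReal.ofReal (1 / (2 * Real.pi)) * ∫⁻ v, B v := by
  simp only [heatAverage, zero_mul, zero_div, neg_zero, Real.exp_zero, ENNReal.ofReal_one, one_mul]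
  rw [lintegral_add_left_eq_self]

section Limit

variable {ι : Type*} {F : Filter ι} [F.IsCountablyGenerated] {e : ι → ℝ}
  {Bi : ι → ℝ → ℝ → ℝ≥0∞} {B : ℝ → ℝ → ℝ≥0∞}

theorem tendsto_heatAverage {b : ι → ℝ → ℝ≥0∞} {b' : ℝ → ℝ≥0∞} (he : Tendsto e F (𝓝 0))
    (he0 : ∀ᶠ i in F, 0 ≤ e i) (hm : ∀ᶠ i in F, Measurable (b i))
    (hle : ∀ᶠ i in F, ∀ v, b i v ≤ b' v) (hfin : ∀ v, b' v ≠ ∞) (hint : ∫⁻ v, b' v ≠ ∞)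
    (hlim : ∀ v, Tendsto (fun i => b i v) F (𝓝 (b' v))) (u : ℝ) :
    Tendsto (fun i => heatAverage (e i) (b i) u) F (𝓝 (heatAverage 0 b' u)) := by
  refine ENNReal.Tendsto.const_mul ?_ (Or.inr ENNReal.ofReal_ne_top)
  refine tendsto_lintegral_filter_of_dominated_convergence (fun v => b' (u + v)) ?_ ?_ ?_ ?_
  · filter_upwards [hm] with i hi
    exact Measurable.mul (by fun_prop) (hi.comp (by fun_prop))
  · filter_upwards [hle, he0] with i hi hi0
    refine ae_of_all _ fun v => (mul_le_of_le_one_left' ?_).trans (hi _)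
    rw [ENNReal.ofReal_le_one, Real.exp_le_one_iff]
    have : 0 ≤ e i * v ^ 2 / 2 := by positivity
    linarith
  · rwa [lintegral_add_left_eq_self]
  · refine ae_of_all _ fun v => ENNReal.Tendsto.mul ?_ (Or.inr (hfin _)) (hlim _)
      (Or.inr ENNReal.ofReal_ne_top)
    refine ENNReal.tendsto_ofReal ?_
    have hc : Continuous fun x : ℝ => Real.exp (-(x * v ^ 2 / 2)) := by fun_prop
    exact (hc.tendsto 0).comp he

/-- Dominated convergence in `v`, then in `s`. The hypotheses are for `s > 0` only: at `s = 0` the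
first stage is the constant `1`, which is not integrable in `v`. -/
theorem tendsto_stableStep (he : Tendsto e F (𝓝 0)) (he0 : ∀ᶠ i in F, 0 ≤ e i)
    (hm : ∀ᶠ i in F, Measurable (Function.uncurry (Bi i)))
    (hle : ∀ᶠ i in F, ∀ s v, Bi i s v ≤ B s v) (hfin : ∀ s > 0, ∀ v, B s v ≠ ∞)
    (hint : ∀ s > 0, ∫⁻ v, B s v ≠ ∞)
    (hlim : ∀ s > 0, ∀ v, Tendsto (fun i => Bi i s v) F (𝓝 (B s v))) {t u : ℝ}
    (hstep : stableStep α 0 B t u ≠ ∞) :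
    Tendsto (fun i => stableStep α (e i) (Bi i) t u) F (𝓝 (stableStep α 0 B t u)) := by
  refine tendsto_lintegral_filter_of_dominated_convergence (fun s =>
    ENNReal.ofReal (Real.exp (-((t - s) * |u| ^ α))) * heatAverage 0 (B s) u) ?_ ?_ hstep ?_
  · filter_upwards [hm] with i hi
    have h2 : Measurable fun s : ℝ => heatAverage (e i) (Bi i s) u :=
      (measurable_heatAverage hi (e i)).comp (f := fun s : ℝ => (s, u)) (by fun_prop)
    exact Measurable.mul (by fun_prop) h2
  · filter_upwards [hle, he0] with i hi hi0
    exact ae_of_all _ fun s => mul_le_mul_right (heatAverage_mono hi0 (hi s) u) _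
  · filter_upwards [ae_restrict_mem measurableSet_Ioc] with s hs
    refine ENNReal.Tendsto.const_mul ?_ (Or.inr ENNReal.ofReal_ne_top)
    exact tendsto_heatAverage he he0 (hm.mono fun i hi => hi.comp measurable_prodMk_left)
      (hle.mono fun i hi => hi s) (hfin s hs.1) (hint s hs.1) (hlim s hs.1) u

end Limit

/-! ### Explicit Mittag-Leffler moments. -/

section Explicit

/-- The density at `0` of `X₁`. -/
def stableDensityZero (α : ℝ) : ℝ := Real.Gamma (1 / α + 1) / Real.pi

/-- The scale of the Mittag-Leffler law of the local time. -/
def localTimeScale (α T : ℝ) : ℝ :=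
  stableDensityZero α * Real.Gamma (1 - 1 / α) * T ^ (1 - 1 / α)

theorem stableDensityZero_pos (hα : 1 < α) : 0 < stableDensityZero α :=
  div_pos (Real.Gamma_pos_of_pos (by positivity)) Real.pi_pos

theorem one_sub_inv_pos (hα : 1 < α) : 0 < 1 - 1 / α := by
  rw [sub_pos, div_lt_one (by linarith)]; exact hα

theorem localTimeScale_pos (hα : 1 < α) {T : ℝ} (hT : 0 < T) : 0 < localTimeScale α T := by
  have h1 := stableDensityZero_pos hα
  have h2 := Real.Gamma_pos_of_pos (one_sub_inv_pos hα)
  unfold localTimeScale; positivity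

theorem lintegral_exp_neg_mul_abs_rpow (hα : 1 < α) {s : ℝ} (hs : 0 < s) :
    ENNReal.ofReal (1 / (2 * Real.pi)) * ∫⁻ v : ℝ, ENNReal.ofReal (Real.exp (-(s * |v| ^ α))) =
      ENNReal.ofReal (stableDensityZero α * s ^ (1 - 1 / α - 1)) := by
  rw [← ofReal_integral_eq_lintegral_ofReal (integrable_exp_neg_mul_abs_rpow hα hs)
    (ae_of_all _ fun v => (Real.exp_pos _).le), integral_exp_neg_mul_abs_rpow hα hs,
    ← ENNReal.ofReal_mul (by positivity), stableDensityZero]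
  have h : 1 - 1 / α - 1 = -(1 / α) := by ring
  have := Real.pi_pos
  rw [h]; congr 1
  field_simp

/-- The value of `(2π)⁻¹ ∫ E[exp(i v X_s) l(s)^n] dv`. -/
theorem heatAverage_stableMoment (hα : 1 < α) (n : ℕ) {s : ℝ} (hs : 0 < s) (u : ℝ) :
    heatAverage 0 (stableMoment α 0 n s) u =
      ENNReal.ofReal (n.factorial * (stableDensityZero α * Real.Gamma (1 - 1 / α)) ^ (n + 1) /
        Real.Gamma ((n + 1) * (1 - 1 / α)) * s ^ ((n + 1) * (1 - 1 / α) - 1)) := by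
  have hβ := one_sub_inv_pos hα
  have hc := stableDensityZero_pos hα
  set β := 1 - 1 / α
  set c := stableDensityZero α
  have hG := Real.Gamma_pos_of_pos hβ
  rw [heatAverage_zero]
  induction n generalizing s with
  | zero =>
    simp only [stableMoment]
    rw [lintegral_exp_neg_mul_abs_rpow hα hs]
    simp only [Nat.factorial_zero, Nat.cast_one, zero_add, pow_one, Nat.cast_zero, one_mul]
    congr 1
    rw [mul_div_assoc, div_self hG.ne', mul_one]
  | succ n ih =>
    have hG1 : 0 < Real.Gamma ((n + 1) * β) := Real.Gamma_pos_of_pos (by positivity)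
    have hG2 : 0 < Real.Gamma ((n + 1) * β + β) := Real.Gamma_pos_of_pos (by positivity)
    -- After Tonelli the `v`-integral gives a multiple of `(s - r)^(β-1)`, so each stage convolves
    -- `r^((n+1)β-1)` with this power: a Beta integral.
    have h1 : ∀ v, stableMoment α 0 (n + 1) s v = ((n + 1 : ℕ) : ℝ≥0∞) * ∫⁻ r in Ioc 0 s,
        ENNReal.ofReal (Real.exp (-((s - r) * |v| ^ α))) *
        ENNReal.ofReal (n.factorial * (c * Real.Gamma β) ^ (n + 1) /
        Real.Gamma ((n + 1) * β) * r ^ ((n + 1) * β - 1)) := by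
      intro v
      simp only [stableMoment, stableStep]
      congr 1
      refine setLIntegral_congr_fun measurableSet_Ioc fun r hr => ?_
      rw [heatAverage_zero, ih hr.1]
    simp_rw [h1]
    rw [lintegral_const_mul _ (Measurable.lintegral_prod_right' (f := fun p : ℝ × ℝ =>
      ENNReal.ofReal (Real.exp (-((s - p.2) * |p.1| ^ α))) *
        ENNReal.ofReal (n.factorial * (c * Real.Gamma β) ^ (n + 1) /
        Real.Gamma ((n + 1) * β) * p.2 ^ ((n + 1) * β - 1))) (by fun_prop)),
      lintegral_lintegral_swap (by fun_prop), mul_left_comm]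
    have h2 : ENNReal.ofReal (1 / (2 * Real.pi)) * ∫⁻ r in Ioc 0 s, ∫⁻ v : ℝ,
        ENNReal.ofReal (Real.exp (-((s - r) * |v| ^ α))) *
        ENNReal.ofReal (n.factorial * (c * Real.Gamma β) ^ (n + 1) /
        Real.Gamma ((n + 1) * β) * r ^ ((n + 1) * β - 1)) =
        ∫⁻ r in Ioc 0 s, ENNReal.ofReal (n.factorial * (c * Real.Gamma β) ^ (n + 1) /
        Real.Gamma ((n + 1) * β) * c) * ENNReal.ofReal (r ^ ((n + 1) * β - 1) *
          (s - r) ^ (β - 1)) := by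
      -- The endpoint `r = s` is discarded, since the frequency integral needs `s - r > 0`.
      rw [← lintegral_const_mul' _ _ ENNReal.ofReal_ne_top, setLIntegral_congr Ioo_ae_eq_Ioc.symm,
        setLIntegral_congr Ioo_ae_eq_Ioc.symm]
      refine setLIntegral_congr_fun measurableSet_Ioo fun r hr => ?_
      have hr0 := hr.1
      have hr1 := sub_pos.2 hr.2
      rw [lintegral_mul_const _ (by fun_prop), ← mul_assoc, lintegral_exp_neg_mul_abs_rpow hα hr1,
        ← ENNReal.ofReal_mul (by positivity), ← ENNReal.ofReal_mul (by positivity)]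
      congr 1
      ring
    rw [h2, lintegral_const_mul _ (by fun_prop),
      lintegral_rpow_mul_sub_rpow (by positivity) hβ hs, ← ENNReal.ofReal_mul (by positivity),
      ← ENNReal.ofReal_natCast, ← ENNReal.ofReal_mul (by positivity)]
    congr 1
    have e : (((n + 1 : ℕ) : ℝ) + 1) * β = (n + 1) * β + β := by push_cast; ring
    rw [e, Nat.factorial_succ]
    push_cast
    field_simp
    ring

theorem stableStep_stableMoment_zero (hα : 1 < α) (n : ℕ) {T : ℝ} (hT : 0 < T) :
    stableStep α 0 (stableMoment α 0 n) T 0 =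
      ENNReal.ofReal (localTimeScale α T ^ (n + 1) * n.factorial /
        Real.Gamma ((n + 1) * (1 - 1 / α) + 1)) := by
  have hβ := one_sub_inv_pos hα
  have hc := stableDensityZero_pos hα
  unfold localTimeScale
  set β := 1 - 1 / α
  set c := stableDensityZero α
  have hG := Real.Gamma_pos_of_pos hβ
  have hG1 : 0 < Real.Gamma ((n + 1) * β) := Real.Gamma_pos_of_pos (by positivity)
  have h0 : (0 : ℝ) ^ α = 0 := Real.zero_rpow (by linarith)
  -- At `u = 0` the exponential is `1`, written `(T - s)^(1 - 1)` to fit the Beta integral with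
  -- second parameter `1`.
  have h1 : stableStep α 0 (stableMoment α 0 n) T 0 =
      ∫⁻ s in Ioc 0 T, ENNReal.ofReal (n.factorial * (c * Real.Gamma β) ^ (n + 1) /
        Real.Gamma ((n + 1) * β)) * ENNReal.ofReal (s ^ ((n + 1) * β - 1) *
          (T - s) ^ ((1 : ℝ) - 1)) := by
    refine setLIntegral_congr_fun measurableSet_Ioc fun s hs => ?_
    have := hs.1
    rw [heatAverage_stableMoment hα n hs.1, ← ENNReal.ofReal_mul (by positivity),
      ← ENNReal.ofReal_mul (by positivity)]
    simp [h0, β, c]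
  rw [h1, lintegral_const_mul _ (by fun_prop),
    lintegral_rpow_mul_sub_rpow (by positivity) one_pos hT, ← ENNReal.ofReal_mul (by positivity)]
  congr 1
  rw [Real.Gamma_one, mul_pow (c * Real.Gamma β), ← Real.rpow_natCast (T ^ β), ← Real.rpow_mul hT.le]
  have e : (n + 1) * β + 1 - 1 = β * ((n + 1 : ℕ) : ℝ) := by push_cast; ring
  rw [e]
  field_simp

/-- The moments of the local time. -/
theorem stableMoment_zero_eq (hα : 1 < α) (n : ℕ) {T : ℝ} (hT : 0 < T) :
    stableMoment α 0 n T 0 = ENNReal.ofReal (localTimeScale α T ^ n * n.factorial /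
      Real.Gamma (n * (1 - 1 / α) + 1)) := by
  cases n with
  | zero =>
    have h0 : (0 : ℝ) ^ α = 0 := Real.zero_rpow (by linarith)
    simp [stableMoment, h0]
  | succ n =>
    rw [stableMoment, stableStep_stableMoment_zero hα n hT, ← ENNReal.ofReal_natCast,
      ← ENNReal.ofReal_mul (by positivity), Nat.factorial_succ]
    push_cast
    congr 1
    ring

theorem stableStep_stableMoment_ne_top (hα : 1 < α) (n : ℕ) {t : ℝ} (ht : 0 < t) (u : ℝ) :
    stableStep α 0 (stableMoment α 0 n) t u ≠ ∞ := by
  refine ne_top_of_le_ne_top (b := stableStep α 0 (stableMoment α 0 n) t 0) ?_ ?_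
  · rw [stableStep_stableMoment_zero hα n ht]; exact ENNReal.ofReal_ne_top
  · refine setLIntegral_mono' measurableSet_Ioc fun s hs => ?_
    have h0 : (0 : ℝ) ^ α = 0 := Real.zero_rpow (by linarith)
    rw [heatAverage_stableMoment hα n hs.1, heatAverage_stableMoment hα n hs.1]
    refine mul_le_mul_left (ENNReal.ofReal_le_ofReal (Real.exp_le_exp.2 ?_)) _
    have : 0 ≤ (t - s) * |u| ^ α := mul_nonneg (sub_nonneg.2 hs.2) (by positivity)
    simpa [h0] using this

theorem stableMoment_ne_top (hα : 1 < α) (n : ℕ) {t : ℝ} (ht : 0 < t) (u : ℝ) :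
    stableMoment α 0 n t u ≠ ∞ := by
  cases n with
  | zero => exact ENNReal.ofReal_ne_top
  | succ n =>
    exact ENNReal.mul_ne_top (ENNReal.natCast_ne_top _) (stableStep_stableMoment_ne_top hα n ht u)

theorem lintegral_stableMoment_ne_top (hα : 1 < α) (n : ℕ) {t : ℝ} (ht : 0 < t) :
    ∫⁻ v, stableMoment α 0 n t v ≠ ∞ := by
  intro h
  have h1 := heatAverage_stableMoment hα n ht 0
  rw [heatAverage_zero, h, ENNReal.mul_top] at h1
  · exact ENNReal.ofReal_ne_top h1.symm
  · have := Real.pi_pos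
    rw [Ne, ENNReal.ofReal_eq_zero, not_le]; positivity

variable {ι : Type*} {F : Filter ι} [F.IsCountablyGenerated] {e e' : ι → ℝ}

theorem tendsto_stableMoment (hα : 1 < α) (he : Tendsto e F (𝓝 0)) (he0 : ∀ᶠ i in F, 0 ≤ e i)
    (n : ℕ) {t : ℝ} (ht : 0 < t) (u : ℝ) :
    Tendsto (fun i => stableMoment α (e i) n t u) F (𝓝 (stableMoment α 0 n t u)) := by
  induction n generalizing t u with
  | zero => exact tendsto_const_nhds
  | succ n ih =>
    refine ENNReal.Tendsto.const_mul ?_ (Or.inr (ENNReal.natCast_ne_top _))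
    exact tendsto_stableStep he he0 (Eventually.of_forall fun i => measurable_stableMoment α _ n)
      (he0.mono fun i hi => stableMoment_le hi n) (fun s hs => stableMoment_ne_top hα n hs)
      (fun s hs => lintegral_stableMoment_ne_top hα n hs) (fun s hs v => ih hs v)
      (stableStep_stableMoment_ne_top hα n ht u)

/-- The two parameters vary separately because inner products of `l_ε` and `l_ε'` require a joint
limit. -/
theorem tendsto_stableStep_stableMoment (hα : 1 < α) (he : Tendsto e F (𝓝 0))
    (he0 : ∀ᶠ i in F, 0 ≤ e i) (he' : Tendsto e' F (𝓝 0)) (he0' : ∀ᶠ i in F, 0 ≤ e' i)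
    (n : ℕ) {t : ℝ} (ht : 0 < t) (u : ℝ) :
    Tendsto (fun i => stableStep α (e i) (stableMoment α (e' i) n) t u) F
      (𝓝 (stableStep α 0 (stableMoment α 0 n) t u)) :=
  tendsto_stableStep he he0 (Eventually.of_forall fun _ => measurable_stableMoment α _ n)
    (he0'.mono fun _ hi => stableMoment_le hi n) (fun _ hs => stableMoment_ne_top hα n hs)
    (fun _ hs => lintegral_stableMoment_ne_top hα n hs)
    (fun _ hs v => tendsto_stableMoment hα he' he0' n hs v)
    (stableStep_stableMoment_ne_top hα n ht u)

end Explicit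

end MomentRecursion

end

/-! ### Moments of the regularized local time. -/

namespace IsSymmetricStableProcess

variable {Ω : Type*} {m : MeasurableSpace Ω} {P : Measure Ω}
  {ℱ : Filtration ℝ≥0 m} {X : ℝ≥0 → Ω → ℝ} {α ε : ℝ}

theorem _root_.norm_cexp_I_mul_mul (u x : ℝ) : ‖Complex.exp (Complex.I * u * x)‖ = 1 := by
  rw [Complex.norm_exp]; simp

theorem measurable_uncurry_approxLocalTime_pow (hX : IsSymmetricStableProcess α X ℱ P)
    (hε : 0 < ε) (n : ℕ) : Measurable (Function.uncurry fun (s : ℝ) ω =>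
      approxLocalTime X (max s 0) ε ω ^ n) :=
  (hX.measurable_uncurry_approxLocalTime hε).pow_const n

theorem approxLocalTime_pow_succ (hX : IsSymmetricStableProcess α X ℱ P) (hε : 0 < ε) (n : ℕ)
    {t : ℝ} (ht : 0 ≤ t) (ω : Ω) :
    approxLocalTime X t ε ω ^ (n + 1) = (n + 1) * ∫ s in (0 : ℝ)..t,
      heatKernel ε (X s.toNNReal ω) * approxLocalTime X (max s 0) ε ω ^ n := by
  have h := primitive_pow_succ (hX.measurable_path ε ω) (fun x => abs_heatKernel_le hε _)
    (fun t _ => hX.right_continuous_path ε ω t) n ht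
  rw [approxLocalTime, h]
  congr 1
  refine intervalIntegral.integral_congr fun s hs => ?_
  rw [uIcc_of_le ht] at hs
  simp only [max_eq_left hs.1, approxLocalTime]

variable [IsProbabilityMeasure P]

/-- Fourier inversion under the expectation. -/
theorem integral_cexp_mul_heatKernel_mul (hX : IsSymmetricStableProcess α X ℱ P) (hε : 0 < ε)
    (s : ℝ≥0) (u : ℝ) {G : Ω → ℝ} (hG : Measurable G) {M : ℝ} (hM : ∀ ω, |G ω| ≤ M)
    {b : ℝ → ℝ≥0∞} (hb : Measurable b) (hbfin : ∀ w, b w ≠ ∞)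
    (hGb : ∀ w : ℝ, ∫ ω, Complex.exp (Complex.I * w * X s ω) * (G ω : ℂ) ∂P =
      ((b w).toReal : ℂ)) :
    ∫ ω, Complex.exp (Complex.I * u * X s ω) * ((heatKernel ε (X s ω) * G ω : ℝ) : ℂ) ∂P =
      ((heatAverage ε b u).toReal : ℂ) := by
  have hXm : Measurable (X s) := hX.adapted.measurable
  set K : ℂ := ((1 / (2 * Real.pi) : ℝ) : ℂ)
  have h1 : ∀ ω, Complex.exp (Complex.I * u * X s ω) * ((heatKernel ε (X s ω) * G ω : ℝ) : ℂ) =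
      K * ∫ v : ℝ, ((Real.exp (-(ε * v ^ 2 / 2)) : ℝ) : ℂ) *
        (Complex.exp (Complex.I * (u + v : ℝ) * X s ω) * (G ω : ℂ)) := by
    intro ω
    have e : ∀ a b c d : ℂ, a * (b * c * d) = b * (c * (a * d)) := fun a b c d => by ring
    rw [Complex.ofReal_mul, heatKernel_eq_integral hε, e, ← integral_mul_const]
    congr 1
    refine integral_congr_ae (ae_of_all _ fun v => ?_)
    have : Complex.exp (Complex.I * (u + v : ℝ) * X s ω) =
        Complex.exp (Complex.I * v * X s ω) * Complex.exp (Complex.I * u * X s ω) := by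
      rw [← Complex.exp_add]; congr 1; push_cast; ring
    simp only [this]; ring
  have hgauss : Integrable fun v : ℝ => Real.exp (-(ε * v ^ 2 / 2)) := by
    have := integrable_exp_neg_mul_sq (b := ε / 2) (by positivity)
    refine this.congr (ae_of_all _ fun v => ?_)
    simp only; congr 1; ring
  have hint : Integrable (Function.uncurry fun (ω : Ω) (v : ℝ) =>
      ((Real.exp (-(ε * v ^ 2 / 2)) : ℝ) : ℂ) *
        (Complex.exp (Complex.I * (u + v : ℝ) * X s ω) * (G ω : ℂ))) (P.prod volume) := by
    have h2 : Integrable (fun p : Ω × ℝ => M * Real.exp (-(ε * p.2 ^ 2 / 2))) (P.prod volume) :=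
      Integrable.mul_prod (integrable_const M) hgauss
    refine h2.mono' (Measurable.aestronglyMeasurable (by fun_prop)) (ae_of_all _ fun p => ?_)
    simp only [Function.uncurry]
    rw [norm_mul, norm_mul, norm_cexp_I_mul_mul, one_mul, Complex.norm_real, Complex.norm_real,
      Real.norm_of_nonneg (Real.exp_pos _).le, Real.norm_eq_abs, mul_comm M]
    exact mul_le_mul_of_nonneg_left (hM _) (Real.exp_pos _).le
  have hm : Measurable fun v : ℝ => ENNReal.ofReal (Real.exp (-(ε * v ^ 2 / 2))) * b (u + v) :=
    Measurable.mul (by fun_prop) (hb.comp (by fun_prop))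
  simp_rw [h1]
  rw [integral_const_mul, integral_integral_swap hint, heatAverage, ENNReal.toReal_mul,
    ENNReal.toReal_ofReal (by positivity), Complex.ofReal_mul]
  congr 1
  rw [← integral_toReal hm.aemeasurable (ae_of_all _ fun v =>
      ENNReal.mul_lt_top ENNReal.ofReal_lt_top (hbfin _).lt_top), ← integral_complex_ofReal]
  refine integral_congr_ae (ae_of_all _ fun v => ?_)
  simp only
  rw [integral_const_mul, hGb, ENNReal.toReal_mul, ENNReal.toReal_ofReal (Real.exp_pos _).le,
    Complex.ofReal_mul]

/-- Fubini in `s`, then the Markov property from `t` to `s`, then Fourier inversion at time `s`. The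
process `G` is general so that it may be a regularized local time with a different parameter. -/
theorem integral_cexp_mul_integral (hX : IsSymmetricStableProcess α X ℱ P) (hε : 0 < ε)
    {t : ℝ} (ht : 0 ≤ t) (u : ℝ) {G : ℝ → Ω → ℝ} (hG : Measurable (Function.uncurry G))
    (hGa : ∀ s, 0 ≤ s → Measurable[ℱ s.toNNReal] (G s)) {M : ℝ}
    (hM : ∀ s ∈ Ioc 0 t, ∀ ω, |G s ω| ≤ M) {B : ℝ → ℝ → ℝ≥0∞}
    (hB : Measurable (Function.uncurry B)) (hBfin : ∀ s > 0, ∀ w, B s w ≠ ∞)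
    (hBint : ∀ s > 0, heatAverage ε (B s) u ≠ ∞)
    (hGB : ∀ s > 0, ∀ w : ℝ, ∫ ω, Complex.exp (Complex.I * w * X s.toNNReal ω) * (G s ω : ℂ) ∂P =
      ((B s w).toReal : ℂ)) :
    ∫ ω, Complex.exp (Complex.I * u * X t.toNNReal ω) *
      ((∫ s in (0 : ℝ)..t, heatKernel ε (X s.toNNReal ω) * G s ω : ℝ) : ℂ) ∂P =
      ((stableStep α ε B t u).toReal : ℂ) := by
  have hXt : Measurable (X t.toNNReal) := hX.adapted.measurable
  set D := 1 / Real.sqrt (2 * Real.pi * ε)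
  have hk : Measurable fun p : Ω × ℝ => heatKernel ε (X p.2.toNNReal p.1) :=
    (continuous_heatKernel ε).measurable.comp (hX.measurable_uncurry.comp measurable_swap)
  have hG' : Measurable fun p : Ω × ℝ => G p.2 p.1 := hG.comp measurable_swap
  have h1 : ∀ ω, Complex.exp (Complex.I * u * X t.toNNReal ω) *
      ((∫ s in (0 : ℝ)..t, heatKernel ε (X s.toNNReal ω) * G s ω : ℝ) : ℂ) =
      ∫ s in Ioc 0 t, Complex.exp (Complex.I * u * X t.toNNReal ω) *
        ((heatKernel ε (X s.toNNReal ω) * G s ω : ℝ) : ℂ) := by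
    intro ω
    rw [intervalIntegral.integral_of_le ht, ← integral_complex_ofReal, integral_const_mul]
  have hint : Integrable (Function.uncurry fun (ω : Ω) (s : ℝ) =>
      Complex.exp (Complex.I * u * X t.toNNReal ω) *
        ((heatKernel ε (X s.toNNReal ω) * G s ω : ℝ) : ℂ)) (P.prod (volume.restrict (Ioc 0 t))) := by
    refine Integrable.of_bound (C := D * M) (Measurable.aestronglyMeasurable ?_) ?_
    · exact Measurable.mul (by fun_prop) (Complex.measurable_ofReal.comp (hk.mul hG'))
    · filter_upwards [Measure.quasiMeasurePreserving_snd.ae (ae_restrict_mem measurableSet_Ioc)]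
        with p hp
      simp only [Function.uncurry]
      rw [norm_mul, norm_cexp_I_mul_mul, one_mul, Complex.norm_real, Real.norm_eq_abs, abs_mul]
      exact mul_le_mul (abs_heatKernel_le hε _) (hM _ hp _) (abs_nonneg _) (by positivity)
  simp_rw [h1]
  rw [integral_integral_swap hint, stableStep]
  have hmeas : Measurable fun s : ℝ => heatAverage ε (B s) u :=
    (measurable_heatAverage hB ε).comp (f := fun s : ℝ => (s, u)) (by fun_prop)
  have hmeas' : Measurable fun s : ℝ =>
      ENNReal.ofReal (Real.exp (-((t - s) * |u| ^ α))) * heatAverage ε (B s) u :=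
    Measurable.mul (by fun_prop) hmeas
  rw [← integral_toReal hmeas'.aemeasurable ?_,
    ← integral_complex_ofReal]
  · refine setIntegral_congr_fun measurableSet_Ioc fun s hs => ?_
    have hst : s.toNNReal ≤ t.toNNReal := Real.toNNReal_le_toNNReal hs.2
    have hg : Measurable[ℱ s.toNNReal] fun ω =>
        ((heatKernel ε (X s.toNNReal ω) * G s ω : ℝ) : ℂ) :=
      Complex.measurable_ofReal.comp (((continuous_heatKernel ε).measurable.comp
        (hX.adapted s.toNNReal)).mul (hGa s hs.1.le))
    have h2 := hX.integral_cexp_mul hst u hg (M := D * M) fun ω => by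
      rw [Complex.norm_real, Real.norm_eq_abs, abs_mul]
      exact mul_le_mul (abs_heatKernel_le hε _) (hM _ hs _) (abs_nonneg _) (by positivity)
    rw [Real.coe_toNNReal _ ht, Real.coe_toNNReal _ hs.1.le] at h2
    rw [h2, hX.integral_cexp_mul_heatKernel_mul hε s.toNNReal u
      ((hGa s hs.1.le).mono (ℱ.le _) le_rfl) (hM s hs) (hB.comp measurable_prodMk_left)
      (hBfin s hs.1) (hGB s hs.1), ENNReal.toReal_mul, ENNReal.toReal_ofReal (Real.exp_pos _).le,
      Complex.ofReal_mul, neg_mul]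
    rfl
  · filter_upwards [ae_restrict_mem measurableSet_Ioc] with s hs
    exact ENNReal.mul_lt_top ENNReal.ofReal_lt_top (hBint s hs.1).lt_top

theorem stableMoment_ne_top' (hα : 1 < α) (hε : 0 ≤ ε) (n : ℕ) {s : ℝ} (hs : 0 < s) (w : ℝ) :
    stableMoment α ε n s w ≠ ∞ :=
  ne_top_of_le_ne_top (stableMoment_ne_top hα n hs w) (stableMoment_le hε n s w)

theorem heatAverage_stableMoment_ne_top (hα : 1 < α) {ε' : ℝ} (hε : 0 ≤ ε) (hε' : 0 ≤ ε') (n : ℕ)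
    {s : ℝ} (hs : 0 < s) (u : ℝ) : heatAverage ε (stableMoment α ε' n s) u ≠ ∞ := by
  refine ne_top_of_le_ne_top ?_ (heatAverage_mono hε (stableMoment_le hε' n s) u)
  rw [heatAverage_stableMoment hα n hs]
  exact ENNReal.ofReal_ne_top

theorem abs_approxLocalTime_pow_le (hε : 0 < ε) (n : ℕ) {t : ℝ} :
    ∀ s ∈ Ioc 0 t, ∀ ω, |approxLocalTime X (max s 0) ε ω ^ n| ≤
      (1 / Real.sqrt (2 * Real.pi * ε) * t) ^ n := by
  intro s hs ω
  rw [max_eq_left hs.1.le, abs_pow, abs_of_nonneg (approxLocalTime_nonneg X ε hs.1.le ω)]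
  refine pow_le_pow_left₀ (approxLocalTime_nonneg X ε hs.1.le ω)
    ((approxLocalTime_le X hε hs.1.le ω).trans ?_) n
  exact mul_le_mul_of_nonneg_left hs.2 (by positivity)

/-- All frequencies `u` are carried through the induction, since `heatAverage` integrates the
previous stage over every frequency. -/
theorem integral_cexp_mul_approxLocalTime_pow (hX : IsSymmetricStableProcess α X ℱ P)
    (hα : 1 < α) (hε : 0 < ε) (n : ℕ) {t : ℝ} (ht : 0 ≤ t) (u : ℝ) :
    ∫ ω, Complex.exp (Complex.I * u * X t.toNNReal ω) * ((approxLocalTime X t ε ω ^ n : ℝ) : ℂ) ∂P =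
      ((stableMoment α ε n t u).toReal : ℂ) := by
  induction n generalizing t u with
  | zero =>
    simp only [pow_zero, Complex.ofReal_one, mul_one, stableMoment]
    rw [hX.integral_cexp, ENNReal.toReal_ofReal (Real.exp_pos _).le, Real.coe_toNNReal _ ht]
  | succ n ih =>
    simp_rw [hX.approxLocalTime_pow_succ hε n ht]
    have h := hX.integral_cexp_mul_integral hε ht u
      (hX.measurable_uncurry_approxLocalTime_pow hε n)
      (fun s hs => by
        simp only [max_eq_left hs]
        exact (hX.measurable_approxLocalTime ε hs).pow_const n)
      (abs_approxLocalTime_pow_le hε n) (measurable_stableMoment α ε n)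
      (fun s hs w => stableMoment_ne_top' hα hε.le n hs w)
      (fun s hs => heatAverage_stableMoment_ne_top hα hε.le hε.le n hs u)
      (fun s hs w => by
        simp only [max_eq_left (le_of_lt hs)]
        exact ih (le_of_lt hs) w)
    simp_rw [Complex.ofReal_mul, mul_left_comm (Complex.exp _)]
    rw [integral_const_mul, h, stableMoment, ENNReal.toReal_mul, Complex.ofReal_mul,
      ENNReal.toReal_natCast]
    push_cast
    rfl

/-- The moments of the regularized local time. -/
theorem lintegral_approxLocalTime_pow (hX : IsSymmetricStableProcess α X ℱ P)
    (hα : 1 < α) (hε : 0 < ε) (n : ℕ) {T : ℝ} (hT : 0 < T) :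
    ∫⁻ ω, ENNReal.ofReal (approxLocalTime X T ε ω ^ n) ∂P = stableMoment α ε n T 0 := by
  have h := hX.integral_cexp_mul_approxLocalTime_pow hα hε n hT.le 0
  simp only [Complex.ofReal_zero, mul_zero, zero_mul, Complex.exp_zero, one_mul] at h
  rw [integral_complex_ofReal, Complex.ofReal_inj] at h
  have hm : Measurable (approxLocalTime X T ε) :=
    (hX.measurable_approxLocalTime ε hT.le).mono (ℱ.le _) le_rfl
  have hint : Integrable (fun ω => approxLocalTime X T ε ω ^ n) P := by
    refine Integrable.of_bound (C := (1 / Real.sqrt (2 * Real.pi * ε) * T) ^ n)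
      (hm.pow_const n).aestronglyMeasurable (ae_of_all _ fun ω => ?_)
    have := abs_approxLocalTime_pow_le (X := X) hε n T (right_mem_Ioc.2 hT) ω
    rwa [max_eq_left hT.le] at this
  rw [← ofReal_integral_eq_lintegral_ofReal hint
    (ae_of_all _ fun ω => pow_nonneg (approxLocalTime_nonneg X ε hT.le ω) n), h,
    ENNReal.ofReal_toReal (stableMoment_ne_top' hα hε.le n hT 0)]

theorem integrable_integral_heatKernel_mul (hX : IsSymmetricStableProcess α X ℱ P) (hε : 0 < ε)
    {t : ℝ} (ht : 0 ≤ t) {G : ℝ → Ω → ℝ} (hG : Measurable (Function.uncurry G)) {M : ℝ}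
    (hM : ∀ s ∈ Ioc 0 t, ∀ ω, |G s ω| ≤ M) :
    Integrable (fun ω => ∫ s in (0 : ℝ)..t, heatKernel ε (X s.toNNReal ω) * G s ω) P := by
  have h1 : Measurable fun p : Ω × ℝ => heatKernel ε (X p.2.toNNReal p.1) * G p.2 p.1 :=
    ((continuous_heatKernel ε).measurable.comp (hX.measurable_uncurry.comp measurable_swap)).mul
      (hG.comp measurable_swap)
  have h2 := (h1.stronglyMeasurable.integral_prod_right' (ν := volume.restrict (Ioc 0 t)))
  simp_rw [intervalIntegral.integral_of_le ht]
  refine Integrable.of_bound h2.aestronglyMeasurable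
    (1 / Real.sqrt (2 * Real.pi * ε) * M * volume.real (Ioc 0 t)) (ae_of_all _ fun ω => ?_)
  refine norm_setIntegral_le_of_norm_le_const (by simp) fun s hs => ?_
  rw [Real.norm_eq_abs, abs_mul]
  exact mul_le_mul (abs_heatKernel_le hε _) (hM s hs ω) (abs_nonneg _) (by positivity)

/-- The mixed second moments of the regularized local times. -/
theorem integral_approxLocalTime_mul (hX : IsSymmetricStableProcess α X ℱ P) (hα : 1 < α)
    {ε' : ℝ} (hε : 0 < ε) (hε' : 0 < ε') {T : ℝ} (hT : 0 < T) :
    ∫ ω, approxLocalTime X T ε ω * approxLocalTime X T ε' ω ∂P =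
      (stableStep α ε (stableMoment α ε' 1) T 0).toReal +
      (stableStep α ε' (stableMoment α ε 1) T 0).toReal := by
  have key : ∀ {ε ε' : ℝ}, 0 < ε → 0 < ε' →
      ∫ ω, (∫ s in (0 : ℝ)..T, heatKernel ε (X s.toNNReal ω) *
        approxLocalTime X (max s 0) ε' ω ^ 1) ∂P =
      (stableStep α ε (stableMoment α ε' 1) T 0).toReal := by
    intro ε ε' hε hε'
    have h := hX.integral_cexp_mul_integral hε hT.le 0
      (hX.measurable_uncurry_approxLocalTime_pow hε' 1)
      (fun s hs => by
        simp only [max_eq_left hs]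
        exact (hX.measurable_approxLocalTime ε' hs).pow_const 1)
      (abs_approxLocalTime_pow_le hε' 1) (measurable_stableMoment α ε' 1)
      (fun s hs w => stableMoment_ne_top' hα hε'.le 1 hs w)
      (fun s hs => heatAverage_stableMoment_ne_top hα hε.le hε'.le 1 hs 0)
      (fun s hs w => by
        simp only [max_eq_left (le_of_lt hs)]
        exact hX.integral_cexp_mul_approxLocalTime_pow hα hε' 1 (le_of_lt hs) w)
    simp only [Complex.ofReal_zero, mul_zero, zero_mul, Complex.exp_zero, one_mul] at h
    rw [integral_complex_ofReal, Complex.ofReal_inj] at h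
    exact h
  have hm : ∀ {ε ε' : ℝ}, 0 < ε → 0 < ε' → Integrable (fun ω => ∫ s in (0 : ℝ)..T,
      heatKernel ε (X s.toNNReal ω) * approxLocalTime X (max s 0) ε' ω ^ 1) P := fun hε hε' =>
    hX.integrable_integral_heatKernel_mul hε hT.le
      (hX.measurable_uncurry_approxLocalTime_pow hε' 1) (abs_approxLocalTime_pow_le hε' 1)
  rw [← key hε hε', ← key hε' hε, ← integral_add (hm hε hε') (hm hε' hε)]
  refine integral_congr_ae (ae_of_all _ fun ω => ?_)
  have h := primitive_mul_primitive (hX.measurable_path ε ω) (fun x => abs_heatKernel_le hε _)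
    (fun t _ => hX.right_continuous_path ε ω t) (hX.measurable_path ε' ω)
    (fun x => abs_heatKernel_le hε' _) (fun t _ => hX.right_continuous_path ε' ω t) hT.le
  simp only [approxLocalTime, pow_one]
  rw [h]
  congr 1 <;>
  · refine intervalIntegral.integral_congr fun s hs => ?_
    rw [uIcc_of_le hT.le] at hs
    simp only [max_eq_left hs.1]

end IsSymmetricStableProcess

/-! ### Convergence in Hilbert space and of moments. -/

section Convergence

/-- A family whose inner products converge along the product filter is convergent. -/
theorem exists_tendsto_of_tendsto_inner {H ι : Type*} [NormedAddCommGroup H]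
    [InnerProductSpace ℝ H] [CompleteSpace H] {F : Filter ι} [F.NeBot] {φ : ι → H} {c : ℝ}
    (h : Tendsto (fun p : ι × ι => inner ℝ (φ p.1) (φ p.2)) (F ×ˢ F) (𝓝 c)) :
    ∃ x, Tendsto φ F (𝓝 x) := by
  rw [← cauchy_map_iff_exists_tendsto, cauchy_map_iff]
  refine ⟨inferInstance, ?_⟩
  rw [tendsto_uniformity_iff_dist_tendsto_zero]
  -- The diagonal has the same limit `c`, so squared distances tend to `c - 2c + c = 0`.
  have h1 : Tendsto (fun i => inner ℝ (φ i) (φ i)) F (𝓝 c) := h.comp (tendsto_id.prodMk tendsto_id)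
  have h2 : Tendsto (fun p : ι × ι => Real.sqrt (inner ℝ (φ p.1) (φ p.1) -
      2 * inner ℝ (φ p.1) (φ p.2) + inner ℝ (φ p.2) (φ p.2))) (F ×ˢ F) (𝓝 0) := by
    have h3 := ((h1.comp tendsto_fst).sub (h.const_mul 2)).add (h1.comp (tendsto_snd (f := F)))
    have h4 : c - 2 * c + c = 0 := by ring
    rw [h4] at h3
    have h5 := (Real.continuous_sqrt.tendsto 0).comp h3
    rw [Real.sqrt_zero] at h5
    exact h5
  refine h2.congr fun p => ?_
  rw [dist_eq_norm, ← Real.sqrt_sq (norm_nonneg _), norm_sub_sq_real, real_inner_self_eq_norm_sq,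
    real_inner_self_eq_norm_sq]

variable {Ω : Type*} {m : MeasurableSpace Ω} {P : Measure Ω}

/-- Fatou's lemma for Bochner integrals. -/
theorem integral_le_of_tendsto_ae {g : ℕ → Ω → ℝ} {g' : Ω → ℝ} {c : ℝ}
    (hg0 : ∀ k ω, 0 ≤ g k ω) (hgi : ∀ k, Integrable (g k) P)
    (hlim : ∀ᵐ ω ∂P, Tendsto (fun k => g k ω) atTop (𝓝 (g' ω)))
    (hc : Tendsto (fun k => ∫ ω, g k ω ∂P) atTop (𝓝 c)) :
    Integrable g' P ∧ ∫ ω, g' ω ∂P ≤ c := by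
  have hm : AEStronglyMeasurable g' P :=
    aestronglyMeasurable_of_tendsto_ae atTop (fun k => (hgi k).aestronglyMeasurable) hlim
  have h0 : ∀ᵐ ω ∂P, 0 ≤ g' ω := by
    filter_upwards [hlim] with ω h using ge_of_tendsto' h fun k => hg0 k ω
  have hc0 : 0 ≤ c := ge_of_tendsto' hc fun k => integral_nonneg (hg0 k)
  have h1 : ∫⁻ ω, ENNReal.ofReal (g' ω) ∂P ≤ ENNReal.ofReal c := by
    calc ∫⁻ ω, ENNReal.ofReal (g' ω) ∂P
        = ∫⁻ ω, liminf (fun k => ENNReal.ofReal (g k ω)) atTop ∂P := by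
          refine lintegral_congr_ae ?_
          filter_upwards [hlim] with ω h using (ENNReal.tendsto_ofReal h).liminf_eq.symm
      _ ≤ liminf (fun k => ∫⁻ ω, ENNReal.ofReal (g k ω) ∂P) atTop :=
          lintegral_liminf_le' fun k => (hgi k).aestronglyMeasurable.aemeasurable.ennreal_ofReal
      _ = ENNReal.ofReal c := by
          simp_rw [fun k => (ofReal_integral_eq_lintegral_ofReal (hgi k)
            (ae_of_all _ (hg0 k))).symm]
          exact (ENNReal.tendsto_ofReal hc).liminf_eq
  have hi : Integrable g' P :=
    ⟨hm, (hasFiniteIntegral_iff_ofReal h0).2 (h1.trans_lt ENNReal.ofReal_lt_top)⟩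
  refine ⟨hi, ?_⟩
  rwa [← ofReal_integral_eq_lintegral_ofReal hi h0, ENNReal.ofReal_le_ofReal_iff hc0] at h1

/-- If all moments converge, so do the moments of an almost sure limit. -/
theorem integral_pow_eq_of_tendsto_ae [IsProbabilityMeasure P] {f : ℕ → Ω → ℝ} {f' : Ω → ℝ}
    {c : ℕ → ℝ} (hf0 : ∀ k ω, 0 ≤ f k ω) (hfi : ∀ k n, Integrable (fun ω => f k ω ^ n) P)
    (hlim : ∀ᵐ ω ∂P, Tendsto (fun k => f k ω) atTop (𝓝 (f' ω)))
    (hc : ∀ n, Tendsto (fun k => ∫ ω, f k ω ^ n ∂P) atTop (𝓝 (c n))) (n : ℕ) :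
    Integrable (fun ω => f' ω ^ n) P ∧ ∫ ω, f' ω ^ n ∂P = c n := by
  have h1 : ∀ n, Integrable (fun ω => f' ω ^ n) P ∧ ∫ ω, f' ω ^ n ∂P ≤ c n := fun n =>
    integral_le_of_tendsto_ae (fun k ω => pow_nonneg (hf0 k ω) n) (fun k => hfi k n)
      (hlim.mono fun ω h => h.pow n) (hc n)
  refine ⟨(h1 n).1, le_antisymm (h1 n).2 ?_⟩
  -- Fatou gives only one inequality. The other comes from Fatou for `δ x^(2n) - x^n + 1/(4δ)`,
  -- which is nonnegative because it equals `δ (x^n - 1/(2δ))²`; then `δ ↓ 0`.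
  have h2 : ∀ δ > 0, c n ≤ ∫ ω, f' ω ^ n ∂P + δ * c (2 * n) := by
    intro δ hδ
    have hint : ∀ x : Ω → ℝ, Integrable (fun ω => x ω ^ n) P →
        Integrable (fun ω => x ω ^ (2 * n)) P →
        Integrable (fun ω => δ * x ω ^ (2 * n) - x ω ^ n + 1 / (4 * δ)) P ∧
        ∫ ω, (δ * x ω ^ (2 * n) - x ω ^ n + 1 / (4 * δ)) ∂P =
          δ * ∫ ω, x ω ^ (2 * n) ∂P - ∫ ω, x ω ^ n ∂P + 1 / (4 * δ) := by
      intro x hx1 hx2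
      have h3 : Integrable (fun ω => δ * x ω ^ (2 * n) - x ω ^ n) P := (hx2.const_mul δ).sub hx1
      refine ⟨h3.add (integrable_const _), ?_⟩
      rw [integral_add h3 (integrable_const _), integral_sub (hx2.const_mul δ) hx1,
        integral_const_mul]
      simp
    have h4 := integral_le_of_tendsto_ae
      (g := fun k ω => δ * f k ω ^ (2 * n) - f k ω ^ n + 1 / (4 * δ))
      (g' := fun ω => δ * f' ω ^ (2 * n) - f' ω ^ n + 1 / (4 * δ))
      (c := δ * c (2 * n) - c n + 1 / (4 * δ)) (fun k ω => ?_)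
      (fun k => (hint (f k) (hfi k n) (hfi k (2 * n))).1)
      (hlim.mono fun ω h => (((h.pow (2 * n)).const_mul δ).sub (h.pow n)).add_const _) ?_
    · have h5 := h4.2
      rw [(hint f' (h1 n).1 (h1 (2 * n)).1).2] at h5
      have h6 : 0 ≤ δ * ∫ ω, f' ω ^ (2 * n) ∂P :=
        mul_nonneg hδ.le (integral_nonneg fun ω => by rw [pow_mul]; positivity)
      linarith
    · have : δ * f k ω ^ (2 * n) - f k ω ^ n + 1 / (4 * δ) =
          δ * (f k ω ^ n - 1 / (2 * δ)) ^ 2 := by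
        rw [mul_comm 2 n, pow_mul]; field_simp; ring
      simp only [this]; positivity
    · simp_rw [fun k => (hint (f k) (hfi k n) (hfi k (2 * n))).2]
      exact (((hc (2 * n)).const_mul δ).sub (hc n)).add_const _
  have h3 : Tendsto (fun δ : ℝ => ∫ ω, f' ω ^ n ∂P + δ * c (2 * n)) (𝓝[>] 0)
      (𝓝 (∫ ω, f' ω ^ n ∂P + 0 * c (2 * n))) :=
    (Continuous.tendsto (by fun_prop) 0).mono_left nhdsWithin_le_nhds
  rw [zero_mul, add_zero] at h3
  exact ge_of_tendsto h3 (by filter_upwards [self_mem_nhdsWithin] with δ hδ using h2 δ hδ)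

end Convergence

/-! ### Existence, moments and small values of the local time. -/

namespace IsSymmetricStableProcess

variable {Ω : Type*} {m : MeasurableSpace Ω} {P : Measure Ω} [IsProbabilityMeasure P]
  {ℱ : Filtration ℝ≥0 m} {X : ℝ≥0 → Ω → ℝ} {α T : ℝ}

theorem memLp_approxLocalTime (hX : IsSymmetricStableProcess α X ℱ P) {ε : ℝ} (hε : 0 < ε)
    (hT : 0 < T) (p : ℝ≥0∞) : MemLp (approxLocalTime X T ε) p P := by
  have hm : Measurable (approxLocalTime X T ε) :=
    (hX.measurable_approxLocalTime ε hT.le).mono (ℱ.le _) le_rfl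
  refine MemLp.of_bound hm.aestronglyMeasurable (1 / Real.sqrt (2 * Real.pi * ε) * T)
    (ae_of_all _ fun ω => ?_)
  rw [Real.norm_of_nonneg (approxLocalTime_nonneg X ε hT.le ω)]
  exact approxLocalTime_le X hε hT.le ω

theorem tendsto_integral_approxLocalTime_mul (hX : IsSymmetricStableProcess α X ℱ P) (hα : 1 < α)
    (hT : 0 < T) :
    ∃ c, Tendsto (fun p : ℝ × ℝ => ∫ ω, approxLocalTime X T p.1 ω * approxLocalTime X T p.2 ω ∂P)
      (𝓝[>] 0 ×ˢ 𝓝[>] 0) (𝓝 c) := by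
  have h1 : Tendsto (fun p : ℝ × ℝ => p.1) (𝓝[>] 0 ×ˢ 𝓝[>] 0) (𝓝 0) :=
    tendsto_fst.mono_right nhdsWithin_le_nhds
  have h2 : Tendsto (fun p : ℝ × ℝ => p.2) (𝓝[>] 0 ×ˢ 𝓝[>] 0) (𝓝 0) :=
    tendsto_snd.mono_right nhdsWithin_le_nhds
  have h1' : ∀ᶠ p : ℝ × ℝ in 𝓝[>] 0 ×ˢ 𝓝[>] 0, 0 < p.1 :=
    tendsto_fst.eventually (self_mem_nhdsWithin (s := Ioi (0 : ℝ)))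
  have h2' : ∀ᶠ p : ℝ × ℝ in 𝓝[>] 0 ×ˢ 𝓝[>] 0, 0 < p.2 :=
    tendsto_snd.eventually (self_mem_nhdsWithin (s := Ioi (0 : ℝ)))
  have hfin := stableStep_stableMoment_ne_top hα 1 hT 0
  have h3 := tendsto_stableStep_stableMoment hα h1 (h1'.mono fun _ => le_of_lt) h2
    (h2'.mono fun _ => le_of_lt) 1 hT 0
  have h4 := tendsto_stableStep_stableMoment hα h2 (h2'.mono fun _ => le_of_lt) h1
    (h1'.mono fun _ => le_of_lt) 1 hT 0
  refine ⟨_, (((ENNReal.tendsto_toReal hfin).comp h3).add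
    ((ENNReal.tendsto_toReal hfin).comp h4)).congr' ?_⟩
  filter_upwards [h1', h2'] with p hp1 hp2
  rw [hX.integral_approxLocalTime_mul hα hp1 hp2 hT]
  rfl

theorem exists_isLocalTime (hX : IsSymmetricStableProcess α X ℱ P) (hα : 1 < α) (hT : 0 < T) :
    ∃ l : Ω → ℝ, IsLocalTime X T P l := by
  classical
  have hmem := fun (ε : ℝ) (hε : 0 < ε) => hX.memLp_approxLocalTime hε hT 2
  set φ : ℝ → Lp ℝ 2 P := fun ε => if h : 0 < ε then (hmem ε h).toLp else 0
  have hφ : ∀ ε, 0 < ε → φ ε =ᵐ[P] approxLocalTime X T ε := by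
    intro ε hε
    simp only [φ, dif_pos hε]
    exact (hmem ε hε).coeFn_toLp
  obtain ⟨c, hc⟩ := hX.tendsto_integral_approxLocalTime_mul hα hT
  have hinner : Tendsto (fun p : ℝ × ℝ => inner ℝ (φ p.1) (φ p.2)) (𝓝[>] 0 ×ˢ 𝓝[>] 0) (𝓝 c) := by
    refine hc.congr' ?_
    filter_upwards [prod_mem_prod (self_mem_nhdsWithin (s := Ioi (0 : ℝ)))
      (self_mem_nhdsWithin (s := Ioi (0 : ℝ)))] with p hp
    rw [L2.inner_def]
    refine integral_congr_ae ?_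
    filter_upwards [hφ _ hp.1, hφ _ hp.2] with ω h1 h2
    simp [h1, h2, mul_comm]
  obtain ⟨x, hx⟩ := exists_tendsto_of_tendsto_inner hinner
  refine ⟨x, Lp.memLp x, hmem, ?_⟩
  have h1 := (Lp.tendsto_Lp_iff_tendsto_eLpNorm' φ x).1 hx
  refine h1.congr' ?_
  filter_upwards [self_mem_nhdsWithin] with ε hε
  refine eLpNorm_congr_ae ?_
  filter_upwards [hφ ε hε] with ω h
  simp [h]

theorem tendsto_integral_approxLocalTime_pow (hX : IsSymmetricStableProcess α X ℱ P) (hα : 1 < α)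
    (hT : 0 < T) (n : ℕ) {ι : Type*} {F : Filter ι} [F.IsCountablyGenerated] {e : ι → ℝ}
    (he : Tendsto e F (𝓝[>] 0)) :
    Tendsto (fun i => ∫ ω, approxLocalTime X T (e i) ω ^ n ∂P) F
      (𝓝 (localTimeScale α T ^ n * n.factorial / Real.Gamma (n * (1 - 1 / α) + 1))) := by
  have he0 : ∀ᶠ i in F, 0 < e i := he.eventually self_mem_nhdsWithin
  have h1 := tendsto_stableMoment hα (he.mono_right nhdsWithin_le_nhds)
    (he0.mono fun _ => le_of_lt) n hT 0
  have h2 := (ENNReal.tendsto_toReal (stableMoment_ne_top hα n hT 0)).comp h1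
  have hpos := localTimeScale_pos hα hT
  have hβ := one_sub_inv_pos hα
  have hG : 0 < Real.Gamma (n * (1 - 1 / α) + 1) := Real.Gamma_pos_of_pos (by positivity)
  rw [stableMoment_zero_eq hα n hT, ENNReal.toReal_ofReal (by positivity)] at h2
  refine h2.congr' ?_
  filter_upwards [he0] with i hi
  simp only [Function.comp]
  rw [← hX.lintegral_approxLocalTime_pow hα hi n hT, integral_eq_lintegral_of_nonneg_ae
    (ae_of_all _ fun ω => pow_nonneg (approxLocalTime_nonneg X _ hT.le ω) n)
    ((hX.memLp_approxLocalTime hi hT 2).1.pow n)]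

/-- `L²` convergence yields an almost surely convergent subsequence, along which all moments
converge. The argument applies to any version of the limit. -/
theorem integral_localTime_pow (hX : IsSymmetricStableProcess α X ℱ P) (hα : 1 < α)
    (hT : 0 < T) {l : Ω → ℝ} (hl : IsLocalTime X T P l) :
    (∀ᵐ ω ∂P, 0 ≤ l ω) ∧ ∀ n : ℕ, ∫⁻ ω, ENNReal.ofReal (l ω ^ n) ∂P =
      ENNReal.ofReal (localTimeScale α T ^ n * n.factorial / Real.Gamma (n * (1 - 1 / α) + 1)) := by
  obtain ⟨hl2, hmem, hlim⟩ := hl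
  have hseq : Tendsto (fun k : ℕ => 1 / ((k : ℝ) + 1)) atTop (𝓝[>] 0) :=
    tendsto_nhdsWithin_iff.2 ⟨tendsto_one_div_add_atTop_nhds_zero_nat,
      Eventually.of_forall fun k => by simp only [mem_Ioi]; positivity⟩
  have hmeas : TendstoInMeasure P (fun k : ℕ => approxLocalTime X T (1 / ((k : ℝ) + 1))) atTop l :=
    tendstoInMeasure_of_tendsto_eLpNorm two_ne_zero
      (fun k => (hmem _ (by positivity)).1) hl2.1 (hlim.comp hseq)
  obtain ⟨ns, hns, hae⟩ := hmeas.exists_seq_tendsto_ae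
  have hpos : ∀ k, 0 < 1 / ((ns k : ℝ) + 1) := fun k => by positivity
  have h0 : ∀ᵐ ω ∂P, 0 ≤ l ω := by
    filter_upwards [hae] with ω h using ge_of_tendsto' h fun k =>
      approxLocalTime_nonneg X _ hT.le ω
  refine ⟨h0, fun n => ?_⟩
  have h1 := integral_pow_eq_of_tendsto_ae (f := fun k => approxLocalTime X T (1 / ((ns k : ℝ) + 1)))
    (f' := l) (fun k ω => approxLocalTime_nonneg X _ hT.le ω)
    (fun k n => ?_) hae
    (fun n => hX.tendsto_integral_approxLocalTime_pow hα hT n (hseq.comp hns.tendsto_atTop)) n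
  · rw [← h1.2, ofReal_integral_eq_lintegral_ofReal h1.1]
    filter_upwards [h0] with ω h using pow_nonneg h n
  · have h2 := hX.memLp_approxLocalTime (hpos k) hT n
    rcases Nat.eq_zero_or_pos n with rfl | hn
    · simp
    · have h3 := h2.integrable_norm_pow hn.ne'
      refine h3.congr (ae_of_all _ fun ω => ?_)
      simp only [Real.norm_of_nonneg (approxLocalTime_nonneg X _ hT.le ω)]

theorem tendsto_inv_mul_localTime_le (hX : IsSymmetricStableProcess α X ℱ P) (hα : 1 < α)
    (hT : 0 < T) {l : Ω → ℝ} (hl : IsLocalTime X T P l) :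
    Tendsto (fun ε : ℝ => ε⁻¹ * P.real {ω | l ω ≤ ε}) (𝓝[>] 0)
      (𝓝 ((localTimeScale α T)⁻¹ * (Real.Gamma (1 / α))⁻¹)) := by
  have hlm : AEMeasurable l P := hl.1.1.aemeasurable
  obtain ⟨h0, hmom⟩ := hX.integral_localTime_pow hα hT hl
  have : IsProbabilityMeasure (P.map l) := Measure.isProbabilityMeasure_map hlm
  have h := tendsto_inv_mul_measure_Iic (ν := P.map l) (localTimeScale_pos hα hT)
    (one_sub_inv_pos hα) (by have : 0 < 1 / α := by positivity
                             linarith)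
    ((ae_map_iff hlm (measurableSet_le measurable_const measurable_id)).2 h0)
    (fun n => by rw [lintegral_map' (by fun_prop) hlm]; exact hmom n)
  rw [sub_sub_cancel] at h
  refine h.congr fun ε => ?_
  rw [map_measureReal_apply_of_aemeasurable hlm measurableSet_Iic]
  rfl

end IsSymmetricStableProcess

/-- Reflection turns `1 / Γ(1/α)²` into `sin² (π/α) Γ(1 - 1/α)² / π²`; one factor `Γ(1 - 1/α)`
cancels against the scale. -/
theorem inv_localTimeScale_mul_inv_Gamma {α T : ℝ} (hα : 1 < α) (hT : 0 < T) :
    (localTimeScale α T)⁻¹ * (Real.Gamma (1 / α))⁻¹ =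
      α * T ^ (1 / α - 1) / Real.pi * Real.sin (Real.pi / α) ^ 2 * Real.Gamma (1 - 1 / α) := by
  have hα0 : 0 < α := by linarith
  have h1 : 0 < Real.Gamma (1 / α) := Real.Gamma_pos_of_pos (by positivity)
  have hrefl := Real.Gamma_mul_Gamma_one_sub (1 / α)
  have hs : 0 < Real.sin (Real.pi / α) := by
    refine Real.sin_pos_of_pos_of_lt_pi (by positivity) ?_
    rw [div_lt_iff₀ hα0]; nlinarith [Real.pi_pos]
  rw [mul_one_div] at hrefl
  have hG : Real.Gamma (1 - 1 / α) = Real.pi / Real.sin (Real.pi / α) / Real.Gamma (1 / α) := by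
    rw [← hrefl]; field_simp
  have hT' : T ^ (1 - 1 / α) = (T ^ (1 / α - 1))⁻¹ := by
    rw [← Real.rpow_neg hT.le]; congr 1; ring
  rw [localTimeScale, stableDensityZero, hG, Real.Gamma_add_one (by positivity), hT']
  have := Real.pi_pos
  have : 0 < T ^ (1 / α - 1) := by positivity
  field_simp

theorem mainTheorem4 {Ω : Type*} {m : MeasurableSpace Ω} (P : Measure Ω) [IsProbabilityMeasure P]
    (ℱ : Filtration ℝ≥0 m) (X : ℝ≥0 → Ω → ℝ) (α T : ℝ) (hα : 1 < α) (hα' : α ≤ 2) (hT : 0 < T)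
    (hX : IsSymmetricStableProcess α X ℱ P) :
    -- the local time exists in `L²`
    (∃ l : Ω → ℝ, IsLocalTime X T P l) ∧
    -- the integrals in the formula converge
    (∀ z ∈ Complex.slitPlane, Integrable (phiIntegrand α T z)) ∧
    IntegrableOn (contourIntegrand α T) (Ioi 0) ∧
    -- the small ball probability, as a contour integral
    (∀ l : Ω → ℝ, IsLocalTime X T P l →
      Tendsto (fun ε : ℝ => ε⁻¹ * P.real {ω | l ω ≤ ε}) (𝓝[>] 0)
        (𝓝 (2 / T * ∫ r in Ioi (0 : ℝ), contourIntegrand α T r))) ∧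
    -- the explicit value
    (2 / T * ∫ r in Ioi (0 : ℝ), contourIntegrand α T r) =
      α * T ^ (1 / α - 1) / Real.pi * Real.sin (Real.pi / α) ^ 2 * Real.Gamma (1 - 1 / α) := by
  refine ⟨hX.exists_isLocalTime hα hT, fun z hz => (hasDerivAt_phi hα hT hz).1,
    (contourIntegral_eq hα hT).1, fun l hl => ?_, two_div_mul_contourIntegral_eq hα hT⟩
  rw [two_div_mul_contourIntegral_eq hα hT, ← inv_localTimeScale_mul_inv_Gamma hα hT]
  exact hX.tendsto_inv_mul_localTime_le hα hT hl
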